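/- **Setting.** For $x\in\mathbb Z^d$ let $\|x\|=\sum_i|x_i|$. For finite $\Lambda\subset\mathbb Z^d$ let $\partial\Lambda=\{x\notin\Lambda:\ \|x-y\|=1\text{ for some }y\in\Lambda\}$, and let $\Lambda_N=[-N,N]^d\cap\mathbb Z^d$. Let $(\Omega,\mathcal F,\mathbb P)$ be a probability space (the disorder) with expectation $\mathbb E$. Consider the following two random Hamiltonians for heights $\phi$ with boundary condition $\psi$. *Model A.* $(\xi(x))_{x\in\mathbb Z^d}$ are i.i.d. real random variables with finite nonzero second moment; $V\in C^2(\mathbb R)$ is even, with $V(s)\ge As^2-B$ and $V''(s)\le C_2$ for all $s$, for some $A,C_2>0$, $B\in\mathbb R$; and $$H^\psi_\Lambda(\phi)=\tfrac12\sum_{x,y\in\Lambda,\,\|x-y\|=1}V(\phi(x)-\phi(y))+\sum_{x\in\Lambda,\,y\in\partial\Lambda,\,\|x-y\|=1}V(\phi(x)-\psi(y))+\tfrac12\sum_{x\in\Lambda}\xi(x)\phi(x).$$ *Model B.* $(V^\omega_{(x,y)})$ are i.i.d. random functions and $(B^\omega_{(x,y)})$ are i.i.d. real random variables with $\mathbb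 E|B_{(x,y)}|<\infty$, both indexed by the nearest-neighbour bonds (in each of the two families either the directed bonds carry independent variables, or the undirected bonds do and both directions of a bond carry the same variable). The map $(\omega,s)\mapsto V^\omega_{(x,y)}(s)$ is measurable, each $V^\omega_{(x,y)}$ is an even $C^2$ function, and for some constants $A,C_2>0$, almost surely, $As^2-B^\omega_{(x,y)}\le V^\omega_{(x,y)}(s)\le C_2s^2$ for all $s\in\mathbb R$ and all bonds. The Hamiltonian is $$H^\psi_\Lambda(\phi)=\tfrac12\sum_{x,y\in\Lambda,\,\|x-y\|=1}V^\omega_{(x,y)}(\phi(x)-\phi(y))+\sum_{x\in\Lambda,\,y\in\partial\Lambda,\,\|x-y\|=1}V^\omega_{(x,y)}(\phi(x)-\psi(y)).$$ In either model, for fixed disorder, let $\nu^\psi_\Lambda$ be the probability measure on $\mathbb R^{\mathbb Z^d}$ proportional to $e^{-H^\psi_\Lambda(\phi)}\prod_{x\in\Lambda}d\phi(x)\prod_{x\notin\Lambda}\delta_{\psi(x)}(d\phi(x))$. Let $\chi$ be the space of gradient configurations: real functions $\eta$ on the directed nearest-neighbour bonds that are antisymmetric under reversal of a bond and sum to zero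 around each plaquette, with the topology of convergence of each bond variable. Fix $u\in\mathbb R^d$, put $\psi_u(x)=u\cdot x$, $\rho_u=\nabla\psi_u$, and let $\mu^{\rho_u}_\Lambda$ on $\chi$ be the law of $\nabla\phi$, $\nabla\phi(x,y)=\phi(y)-\phi(x)$, under $\nu^{\psi_u}_\Lambda$. Define the spatially and disorder-averaged measure on $\chi$ $$P^u_\Lambda=\int\mathbb P(d\omega)\,\frac1{|\Lambda|}\sum_{x\in\Lambda}\mu^{\rho_u}_{\Lambda+x}[\omega],$$ where the disorder is held fixed while $\Lambda$ is translated. **Proposition.** (A) In model A, let $d\ge3$ and $\mathbb E\,\xi(0)=0$. Then there is a constant $K>0$ such that for all $x_0,y_0\in\mathbb Z^d$ with $\|x_0-y_0\|=1$, $$\limsup_{N\to\infty}P^u_{\Lambda_N}\big[(\phi(x_0)-\phi(y_0)-u\cdot(x_0-y_0))^2\big]\le K .$$ (B) In model B, let $d\ge1$. Then there is a constant $K>0$ such that for all $x_0,y_0\in\mathbb Z^d$ with $\|x_0-y_0\|=1$, $$\limsup_{N\to\infty}P^u_{\Lambda_N}\big[(\phi(x_0)-\phi(y_0))^2\big]\le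 K .$$ In both cases the sequence $(P^u_{\Lambda_N})_{N\in\mathbb N}$ of probability measures on $\chi$ is tight, and every subsequence has a further subsequence that converges weakly to a probability measure on $\chi$, which does not depend on the disorder. -/

import Mathlib

open MeasureTheory ProbabilityTheory Filter Topology
open scoped ENNReal

noncomputable section

namespace RandomInterface

/-- Sites of the lattice `ℤ^d`. -/
abbrev Site (d : ℕ) : Type := Fin d → ℤ

/-- The distance `‖x - y‖ = ∑ i, |x i - y i|` on `ℤ^d`; neighbours are the pairs at distance `1`. -/
def dist1 {d : ℕ} (x y : Site d) : ℤ := ∑ i, |x i - y i|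

theorem dist1_comm {d : ℕ} (x y : Site d) : dist1 x y = dist1 y x :=
  Finset.sum_congr rfl fun i _ => abs_sub_comm (x i) (y i)

/-- The finite set of the lattice neighbours of `x`. -/
def neighbors {d : ℕ} (x : Site d) : Finset (Site d) :=
  (Finset.Icc (x - 1) (x + 1)).filter fun y => dist1 x y = 1

theorem mem_neighbors {d : ℕ} {x y : Site d} : y ∈ neighbors x ↔ dist1 x y = 1 := by
  unfold neighbors
  rw [Finset.mem_filter, Finset.mem_Icc]
  refine ⟨fun h => h.2, fun h => ⟨?_, h⟩⟩
  have key : ∀ i, |x i - y i| ≤ 1 := fun i =>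
    h ▸ Finset.single_le_sum (f := fun j => |x j - y j|) (fun j _ => abs_nonneg _)
      (Finset.mem_univ i)
  constructor
  · intro i
    have := abs_le.1 (key i)
    simp only [Pi.sub_apply, Pi.one_apply]
    linarith
  · intro i
    have := abs_le.1 (key i)
    simp only [Pi.add_apply, Pi.one_apply]
    linarith

/-- The outer boundary `∂Λ` of a finite set of sites. -/
def boundary {d : ℕ} (Λ : Finset (Site d)) : Finset (Site d) := Λ.biUnion neighbors \ Λ

theorem mem_boundary {d : ℕ} {Λ : Finset (Site d)} {x : Site d} :
    x ∈ boundary Λ ↔ x ∉ Λ ∧ ∃ y ∈ Λ, dist1 x y = 1 := by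
  simp only [boundary, Finset.mem_sdiff, Finset.mem_biUnion, mem_neighbors]
  constructor
  · rintro ⟨⟨y, hy, h⟩, hx⟩
    exact ⟨hx, y, hy, by rw [dist1_comm]; exact h⟩
  · rintro ⟨hx, y, hy, h⟩
    exact ⟨⟨y, hy, by rw [dist1_comm]; exact h⟩, hx⟩

/-- The cube `Λ_N = [-N, N]^d ∩ ℤ^d`. -/
def cube (d N : ℕ) : Finset (Site d) := Finset.Icc (fun _ => -(N : ℤ)) (fun _ => (N : ℤ))

/-- The translate `Λ + v`. -/
def translate {d : ℕ} (Λ : Finset (Site d)) (v : Site d) : Finset (Site d) :=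
  Λ.image fun z => z + v

/-- Directed nearest neighbour bonds `b = (x_b, y_b)`, directed from `x_b` to `y_b`. -/
abbrev Bond (d : ℕ) : Type := {b : Site d × Site d // dist1 b.1 b.2 = 1}

/-- The reversed bond `-b`. -/
def Bond.rev {d : ℕ} (b : Bond d) : Bond d := ⟨(b.1.2, b.1.1), by rw [dist1_comm]; exact b.2⟩

/-- A bond field `η` satisfies the plaquette condition: it is antisymmetric, and its sum vanishes
along each closed loop of four bonds that visits four different sites. -/
def PlaquetteCondition {d : ℕ} (η : Bond d → ℝ) : Prop :=
  (∀ b, η b = -η b.rev) ∧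
  ∀ b₁ b₂ b₃ b₄ : Bond d,
    b₁.1.2 = b₂.1.1 → b₂.1.2 = b₃.1.1 → b₃.1.2 = b₄.1.1 → b₄.1.2 = b₁.1.1 →
    [b₁.1.1, b₂.1.1, b₃.1.1, b₄.1.1].Nodup →
    η b₁ + η b₂ + η b₃ + η b₄ = 0

/-- The space `χ` of gradient configurations, with the topology and the σ-algebra
generated by the bond variables. -/
abbrev GradField (d : ℕ) : Type := {η : Bond d → ℝ // PlaquetteCondition η}

/-- The gradient field `∇φ(b) = φ(y_b) - φ(x_b)` of a height field. -/
def grad {d : ℕ} (φ : Site d → ℝ) : GradField d :=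
  ⟨fun b => φ b.1.2 - φ b.1.1, by
    refine ⟨fun b => by simp [Bond.rev], ?_⟩
    intro b₁ b₂ b₃ b₄ h₁ h₂ h₃ h₄ _
    dsimp only
    rw [h₁, h₂, h₃, h₄]
    ring⟩

theorem continuous_grad {d : ℕ} : Continuous (grad : (Site d → ℝ) → GradField d) := by
  unfold grad
  fun_prop

/-- The height configuration equal to `φ` on `Λ` and to the boundary condition `ψ` off `Λ`. -/
def glue {d : ℕ} (Λ : Finset (Site d)) (ψ : Site d → ℝ) (φ : Λ → ℝ) : Site d → ℝ :=
  fun x => if h : x ∈ Λ then φ ⟨x, h⟩ else ψ x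

/-- The Hamiltonian of model A, with potential `V`, external field `ξ` and boundary
condition `ψ`. -/
def hamiltonianA {d : ℕ} (V : ℝ → ℝ) (ξ : Site d → ℝ) (Λ : Finset (Site d)) (ψ φ : Site d → ℝ) :
    ℝ :=
  (1 / 2) * ∑ x ∈ Λ, ∑ y ∈ Λ with dist1 x y = 1, V (φ x - φ y)
    + ∑ x ∈ Λ, ∑ y ∈ boundary Λ with dist1 x y = 1, V (φ x - ψ y)
    + (1 / 2) * ∑ x ∈ Λ, ξ x * φ x

/-- The Hamiltonian of model B, with bond potentials `V b` and boundary condition `ψ`. -/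
def hamiltonianB {d : ℕ} (V : Bond d → ℝ → ℝ) (Λ : Finset (Site d)) (ψ φ : Site d → ℝ) : ℝ :=
  (1 / 2) * ∑ x ∈ Λ, ∑ y ∈ Λ, (if h : dist1 x y = 1 then V ⟨(x, y), h⟩ (φ x - φ y) else 0)
    + ∑ x ∈ Λ, ∑ y ∈ boundary Λ, (if h : dist1 x y = 1 then V ⟨(x, y), h⟩ (φ x - ψ y) else 0)

/-- The measure `exp (-H φ) dφ_Λ δ_ψ(dφ_{ℤ^d \ Λ})` on height configurations. -/
def unnormalizedGibbs {d : ℕ} (H : (Site d → ℝ) → ℝ) (Λ : Finset (Site d)) (ψ : Site d → ℝ) :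
    Measure (Site d → ℝ) :=
  ((volume : Measure (Λ → ℝ)).withDensity
    fun φ => ENNReal.ofReal (Real.exp (-H (glue Λ ψ φ)))).map (glue Λ ψ)

/-- The finite-volume Gibbs measure `ν_Λ^ψ`: the above measure divided by its total mass, the
partition function. -/
def gibbs {d : ℕ} (H : (Site d → ℝ) → ℝ) (Λ : Finset (Site d)) (ψ : Site d → ℝ) :
    Measure (Site d → ℝ) :=
  (unnormalizedGibbs H Λ ψ Set.univ)⁻¹ • unnormalizedGibbs H Λ ψ

/-- The finite-volume gradient Gibbs measure `μ_Λ^ρ` with boundary condition `ρ = ∇ψ`: the law of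
`∇φ` under `ν_Λ^ψ`. -/
def gradGibbs {d : ℕ} (H : (Site d → ℝ) → ℝ) (Λ : Finset (Site d)) (ψ : Site d → ℝ) :
    Measure (GradField d) :=
  (gibbs H Λ ψ).map grad

/-- The linear function `x ↦ u · x` on the lattice, used as boundary condition `ψ_u`. -/
def tilt {d : ℕ} (u : Fin d → ℝ) (x : Site d) : ℝ := ∑ i, u i * (x i : ℝ)

/-- The spatial average `|Λ|⁻¹ ∑_{x ∈ Λ} μ_{Λ+x}^{ρ_u}` with `ρ_u = ∇ψ_u`, for a family `H` of
Hamiltonians `H Λ ψ` indexed by volumes and boundary conditions (the disorder is held fixed). -/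
def spatialAverage {d : ℕ} (H : Finset (Site d) → (Site d → ℝ) → (Site d → ℝ) → ℝ)
    (u : Fin d → ℝ) (Λ : Finset (Site d)) : Measure (GradField d) :=
  (Λ.card : ℝ≥0∞)⁻¹ •
    ∑ x ∈ Λ, gradGibbs (H (translate Λ x) (tilt u)) (translate Λ x) (tilt u)

/-- The spatially averaged gradient measure, averaged over the disorder `ω` with law `P`. -/
def averagedMeasure {d : ℕ} {Ω : Type*} [MeasurableSpace Ω] (P : Measure Ω)
    (H : Ω → Finset (Site d) → (Site d → ℝ) → (Site d → ℝ) → ℝ)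
    (u : Fin d → ℝ) (Λ : Finset (Site d)) : Measure (GradField d) :=
  P.bind fun ω => spatialAverage (H ω) u Λ

/-- The random variables `X b` are i.i.d. over the bonds: either over all directed bonds, or over
the undirected bonds (represented by the bonds that point in a positive coordinate direction),
both orientations of a bond then carrying the same variable. -/
def IIDOverBonds {d : ℕ} {Ω E : Type*} [MeasurableSpace Ω] [MeasurableSpace E] (P : Measure Ω)
    (X : Bond d → Ω → E) : Prop :=
  (∀ b b', IdentDistrib (X b) (X b') P P) ∧
  (iIndepFun X P ∨
    ((∀ b, X b.rev = X b) ∧ iIndepFun (fun b : {b : Bond d // b.1.1 ≤ b.1.2} => X b.1) P))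

/-- All members of a sequence of measures on gradient configurations are probability measures, the
sequence is tight, and each of its subsequences has a further subsequence that converges weakly to
a probability measure. -/
def TightWithLimits {d : ℕ} (μ : ℕ → Measure (GradField d)) : Prop :=
  IsTightMeasureSet (Set.range μ) ∧
  ∃ p : ℕ → ProbabilityMeasure (GradField d),
    (∀ N, (p N : Measure (GradField d)) = μ N) ∧
    ∀ s : ℕ → ℕ, StrictMono s →
      ∃ (t : ℕ → ℕ) (q : ProbabilityMeasure (GradField d)), StrictMono t ∧
        Tendsto (fun k => p (s (t k))) atTop (𝓝 q)

end RandomInterface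

end

/-! Let `D` be the Dirichlet energy of `φ - ψ_u` in a box `Λ`. The heart of the proof is an
exponential moment: for a small `a > 0`, the Gibbs mean of `exp (a D)` is at most `exp c`, where `c`
has disorder mean of order `|Λ|`. Up to such errors the Hamiltonian lies above `2aD` and below `a t²
D` plus a linear term. The numerator is thus at most a Gaussian integral with form `aD`. The
denominator is at least one with form `a t² D`, since an odd term can only increase it. Scaling by
`t` compares the two at the price `t ^ |Λ|`, and `x ≤ c + exp (x - c)` turns the bound into a mean
energy of at most `c + 1` (`lintegral_energy_le`, `gibbs_dirichlet_le`).

In model A the lower bound requires the field to be dominated by the Dirichlet energy. For this, `φ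
x` is written as a sum of gradients along a unit flow from `x` to infinity. In three dimensions such
a flow of finite energy exists; here it is the Pólya urn on `ℕ³`. Then `∑ ξ φ` pairs gradients with
currents, whose second moments are bounded because the `ξ x` are centred and uncorrelated. Young's
inequality concludes (`exists_field_bound`).

The law of the disorder is translation invariant, so averaging a fixed bond over translated boxes
equals averaging over translates of that bond in one box (`lintegral_gibbs_translate`). Their
squared gradients sum to at most `2D`, so the volume cancels and the bound is uniform in bond and
box. Markov's inequality gives tightness and Prokhorov's theorem the limits. -/

namespace RandomInterface

/-! ### Dirichlet energy, and Hamiltonians as sums over bonds -/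

/-- The Dirichlet energy of `φ` over the bonds that issue from a site of `Λ`. -/
noncomputable def dirichlet {d : ℕ} (Λ : Finset (Site d)) (φ : Site d → ℝ) : ℝ :=
  ∑ x ∈ Λ, ∑ y ∈ neighbors x, (φ x - φ y) ^ 2

/-- The weight of the bonds that issue from a site of `Λ` and end in `y`: the bonds inside `Λ` are
counted in both directions. -/
noncomputable def bondWeight {d : ℕ} (Λ : Finset (Site d)) (y : Site d) : ℝ :=
  if y ∈ Λ then 1 / 2 else 1

/-- The bond potentials as functions of pairs of sites, zero on pairs that are not neighbours. -/
noncomputable def pairPotential {d : ℕ} (W : Bond d → ℝ → ℝ) (x y : Site d) (s : ℝ) : ℝ :=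
  if h : dist1 x y = 1 then W ⟨(x, y), h⟩ s else 0

/-- The Hamiltonian with bond potentials `W` and external field `ξ`. -/
noncomputable def hamiltonian {d : ℕ} (W : Bond d → ℝ → ℝ) (ξ : Site d → ℝ) (Λ : Finset (Site d))
    (ψ φ : Site d → ℝ) : ℝ :=
  hamiltonianB W Λ ψ φ + (1 / 2) * ∑ x ∈ Λ, ξ x * φ x

theorem hamiltonianA_eq_hamiltonian {d : ℕ} (V : ℝ → ℝ) (ξ : Site d → ℝ) :
    hamiltonianA V ξ = hamiltonian (fun _ => V) ξ := by
  funext Λ ψ φ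
  simp only [hamiltonianA, hamiltonian, hamiltonianB, Finset.sum_filter, dite_eq_ite]

theorem hamiltonianB_eq_hamiltonian {d : ℕ} (W : Bond d → ℝ → ℝ) :
    hamiltonianB W = hamiltonian W 0 := by
  funext Λ ψ φ
  simp [hamiltonian]

/-- Written over the same directed bonds as `dirichlet`, the Hamiltonian can be compared with the
energy term by term: interior bonds occur twice with weight 1/2, boundary bonds once with weight 1.
-/
theorem hamiltonianB_eq_sum {d : ℕ} (W : Bond d → ℝ → ℝ) (Λ : Finset (Site d))
    {ψ φ : Site d → ℝ} (hφ : ∀ x ∉ Λ, φ x = ψ x) :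
    hamiltonianB W Λ ψ φ =
      ∑ x ∈ Λ, ∑ y ∈ neighbors x, bondWeight Λ y * pairPotential W x y (φ x - φ y) := by
  unfold hamiltonianB
  rw [Finset.mul_sum, ← Finset.sum_add_distrib]
  refine Finset.sum_congr rfl fun x hx => ?_
  rw [← Finset.sum_filter_add_sum_filter_not (neighbors x) (· ∈ Λ), Finset.mul_sum]
  congr 1
  · rw [← Finset.sum_filter_add_sum_filter_not Λ (· ∈ neighbors x)]
    rw [Finset.sum_eq_zero (s := Finset.filter (fun y => ¬ y ∈ neighbors x) Λ), add_zero]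
    · refine Finset.sum_congr ?_ fun y hy => ?_
      · ext y; simp [and_comm]
      · simp only [Finset.mem_filter, mem_neighbors] at hy
        simp [bondWeight, pairPotential, hy.1, hy.2]
    · intro y hy
      simp only [Finset.mem_filter, mem_neighbors] at hy
      simp [hy.2]
  · rw [← Finset.sum_filter_add_sum_filter_not (boundary Λ) (· ∈ neighbors x)]
    rw [Finset.sum_eq_zero (s := Finset.filter (fun y => ¬ y ∈ neighbors x) (boundary Λ)), add_zero]
    · refine Finset.sum_congr ?_ fun y hy => ?_
      · ext y
        simp only [Finset.mem_filter, mem_neighbors, mem_boundary]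
        exact ⟨fun h => ⟨h.2, h.1.1⟩, fun h => ⟨⟨h.2, x, hx, by rw [dist1_comm]; exact h.1⟩, h.1⟩⟩
      · simp only [Finset.mem_filter, mem_neighbors] at hy
        simp [bondWeight, pairPotential, hy.1, hy.2, hφ y hy.2]
    · intro y hy
      simp only [Finset.mem_filter, mem_neighbors] at hy
      simp [hy.2]

theorem glue_of_mem {d : ℕ} {Λ : Finset (Site d)} {ψ : Site d → ℝ} {φ : Λ → ℝ} {x : Site d}
    (hx : x ∈ Λ) : glue Λ ψ φ x = φ ⟨x, hx⟩ := by simp [glue, hx]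

theorem glue_of_notMem {d : ℕ} {Λ : Finset (Site d)} {ψ : Site d → ℝ} {φ : Λ → ℝ} {x : Site d}
    (hx : x ∉ Λ) : glue Λ ψ φ x = ψ x := by simp [glue, hx]

theorem glue_add {d : ℕ} (Λ : Finset (Site d)) (ψ : Site d → ℝ) (φ : Λ → ℝ) :
    glue Λ ψ (φ + fun x : Λ => ψ x) = ψ + glue Λ 0 φ := by
  funext x
  by_cases hx : x ∈ Λ
  · simp [glue_of_mem hx, add_comm]
  · simp [glue_of_notMem hx]

theorem glue_zero_smul {d : ℕ} (Λ : Finset (Site d)) (c : ℝ) (φ : Λ → ℝ) :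
    glue Λ 0 (c • φ) = c • glue Λ 0 φ := by
  funext x
  by_cases hx : x ∈ Λ
  · simp [glue_of_mem hx]
  · simp [glue_of_notMem hx]

theorem measurable_glue {d : ℕ} (Λ : Finset (Site d)) (ψ : Site d → ℝ) :
    Measurable (glue Λ ψ) := by
  refine measurable_pi_lambda _ fun x => ?_
  by_cases hx : x ∈ Λ
  · simp only [glue_of_mem hx]; fun_prop
  · simp only [glue_of_notMem hx]; fun_prop

theorem dirichlet_nonneg {d : ℕ} (Λ : Finset (Site d)) (φ : Site d → ℝ) : 0 ≤ dirichlet Λ φ :=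
  Finset.sum_nonneg fun _ _ => Finset.sum_nonneg fun _ _ => sq_nonneg _

theorem dirichlet_smul {d : ℕ} (Λ : Finset (Site d)) (c : ℝ) (φ : Site d → ℝ) :
    dirichlet Λ (c • φ) = c ^ 2 * dirichlet Λ φ := by
  simp only [dirichlet, Finset.mul_sum, Pi.smul_apply, smul_eq_mul]
  exact Finset.sum_congr rfl fun _ _ => Finset.sum_congr rfl fun _ _ => by ring

theorem measurable_dirichlet {d : ℕ} (Λ : Finset (Site d)) : Measurable (dirichlet Λ) := by
  unfold dirichlet
  fun_prop

/-! ### Gradients controlled by the Dirichlet energy; Poincaré inequality -/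

theorem sum_sq_sub_le_dirichlet {d : ℕ} {Λ : Finset (Site d)} {φ : Site d → ℝ}
    (e : Site d) (he : ∀ x, dist1 x (x + e) = 1) (S : Finset (Site d)) (hS : S ⊆ Λ) :
    ∑ x ∈ S, (φ x - φ (x + e)) ^ 2 ≤ dirichlet Λ φ := by
  refine le_trans (Finset.sum_le_sum_of_subset_of_nonneg hS fun _ _ _ => sq_nonneg _) ?_
  refine Finset.sum_le_sum fun x _ => ?_
  exact Finset.single_le_sum (f := fun y => (φ x - φ y) ^ 2) (fun _ _ => sq_nonneg _)
    (mem_neighbors.2 (he x))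

theorem dist1_add_right {d : ℕ} (x y v : Site d) : dist1 (x + v) (y + v) = dist1 x y := by
  simp [dist1]

theorem dist1_self_add {d : ℕ} (x e : Site d) : dist1 x (x + e) = dist1 0 e := by
  simp [dist1]

/-- The gradients of a field that vanishes off `Λ` along the translates of one bond are controlled
by its Dirichlet energy. -/
theorem sum_sq_sub_le_two_mul_dirichlet {d : ℕ} {Λ : Finset (Site d)} {φ : Site d → ℝ}
    (hφ : ∀ x ∉ Λ, φ x = 0) {e : Site d} (he : dist1 0 e = 1) (S : Finset (Site d)) :
    ∑ x ∈ S, (φ x - φ (x + e)) ^ 2 ≤ 2 * dirichlet Λ φ := by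
  have he1 : ∀ x : Site d, dist1 x (x + e) = 1 := fun x => by rw [dist1_self_add, he]
  have he2 : ∀ x : Site d, dist1 x (x + -e) = 1 := fun x => by
    rw [dist1_comm, ← dist1_add_right _ _ e]; simpa using he1 x
  rw [← Finset.sum_filter_add_sum_filter_not S (· ∈ Λ), two_mul]
  refine add_le_add (sum_sq_sub_le_dirichlet e he1 _ (by intro x; simp)) ?_
  -- A bond that starts off `Λ` either ends in `Λ`, and its reversal is counted by the energy, or
  -- has both ends off `Λ`, where the field vanishes.
  rw [← Finset.sum_filter_add_sum_filter_not (S.filter (¬ · ∈ Λ)) (· + e ∈ Λ)]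
  rw [Finset.sum_eq_zero (s := Finset.filter (fun x => ¬ x + e ∈ Λ) _), add_zero]
  · refine le_trans (le_of_eq ?_) (sum_sq_sub_le_dirichlet (φ := φ) (-e) he2
      ((Finset.filter (fun x => x + e ∈ Λ) (S.filter (¬ · ∈ Λ))).image (· + e)) ?_)
    · rw [Finset.sum_image (fun _ _ _ _ h => add_right_cancel h)]
      refine Finset.sum_congr rfl fun x _ => ?_
      rw [add_neg_cancel_right]; ring
    · intro y hy
      obtain ⟨x, hx, rfl⟩ := Finset.mem_image.1 hy
      exact (Finset.mem_filter.1 hx).2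
  · intro x hx
    simp only [Finset.mem_filter] at hx
    rw [hφ _ hx.2, hφ _ hx.1.2]; simp

theorem dist1_zero_single {d : ℕ} (i : Fin d) : dist1 0 (Pi.single i 1) = 1 := by
  simp only [dist1, Pi.zero_apply, zero_sub, abs_neg]
  rw [Finset.sum_eq_single i] <;> simp +contextual

theorem exists_add_smul_notMem {d : ℕ} (Λ : Finset (Site d)) (i : Fin d) (x : Site d) :
    ∃ n : ℕ, x + n • Pi.single i (1 : ℤ) ∉ Λ := by
  by_contra! h
  have hinj : Function.Injective fun n : ℕ => x + n • Pi.single i (1 : ℤ) := by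
    intro m n hmn
    have := congrFun (add_left_cancel hmn) i
    simpa using this
  exact Set.infinite_of_injective_forall_mem hinj h Λ.finite_toSet

/-- A Poincaré inequality for fields that vanish off `Λ`. -/
theorem exists_sum_sq_le_dirichlet {d : ℕ} (hd : 1 ≤ d) (Λ : Finset (Site d)) :
    ∃ c : ℝ, 0 < c ∧ ∀ φ : Site d → ℝ, (∀ x ∉ Λ, φ x = 0) →
      c * ∑ x ∈ Λ, φ x ^ 2 ≤ dirichlet Λ φ := by
  let i : Fin d := ⟨0, hd⟩
  -- Walk in direction `i` until the field is zero: each step changes it by at most `√(2D)`. The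
  -- dependence of the constant on `Λ` is harmless, as it only serves to make a Gaussian integral
  -- finite.
  choose n hn using exists_add_smul_notMem Λ i
  have key : ∀ φ : Site d → ℝ, (∀ x ∉ Λ, φ x = 0) → ∀ (n : ℕ) (x : Site d),
      x + n • Pi.single i (1 : ℤ) ∉ Λ → |φ x| ≤ n * √(2 * dirichlet Λ φ) := by
    intro φ hφ n
    induction n with
    | zero => intro x hx; simp only [zero_smul, add_zero] at hx; simp [hφ x hx]
    | succ n ih =>
      intro x hx
      have h1 := ih (x + Pi.single i 1) (by
        rw [add_assoc, ← succ_nsmul']; exact hx)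
      have h2 : |φ x - φ (x + Pi.single i 1)| ≤ √(2 * dirichlet Λ φ) := by
        apply Real.abs_le_sqrt
        simpa using sum_sq_sub_le_two_mul_dirichlet hφ (dist1_zero_single i) {x}
      have h3 : |φ x| ≤ |φ x - φ (x + Pi.single i 1)| + |φ (x + Pi.single i 1)| := by
        linarith [abs_sub_abs_le_abs_sub (φ x) (φ (x + Pi.single i 1))]
      push_cast
      linarith
  set M : ℝ := ∑ x ∈ Λ, (n x : ℝ) ^ 2 * 2 with hM
  have hM0 : 0 ≤ M := Finset.sum_nonneg fun _ _ => by positivity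
  refine ⟨(M + 1)⁻¹, by positivity, fun φ hφ => ?_⟩
  have h1 : ∑ x ∈ Λ, φ x ^ 2 ≤ M * dirichlet Λ φ := by
    rw [hM, Finset.sum_mul]
    refine Finset.sum_le_sum fun x _ => ?_
    have h := key φ hφ (n x) x (hn x)
    have h0 := dirichlet_nonneg Λ φ
    rw [← sq_abs]
    calc |φ x| ^ 2 ≤ (n x * √(2 * dirichlet Λ φ)) ^ 2 := by gcongr
      _ = _ := by rw [mul_pow, Real.sq_sqrt (by positivity)]; ring
  rw [inv_mul_le_iff₀ (by positivity)]
  nlinarith [dirichlet_nonneg Λ φ]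

theorem card_neighbors_le {d : ℕ} (x : Site d) : (neighbors x).card ≤ 3 ^ d := by
  refine (Finset.card_filter_le _ _).trans (le_of_eq ?_)
  rw [Pi.card_Icc]
  simp only [Int.card_Icc, Pi.add_apply, Pi.sub_apply, Pi.one_apply]
  rw [Finset.prod_congr rfl (g := fun _ => 3) fun i _ => by omega]
  simp

theorem bondWeight_bounds {d : ℕ} (Λ : Finset (Site d)) (y : Site d) :
    1 / 2 ≤ bondWeight Λ y ∧ bondWeight Λ y ≤ 1 := by
  unfold bondWeight
  split_ifs <;> norm_num

/-! ### Comparison with Gaussian integrals -/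

theorem lintegral_comp_smul_pi {ι : Type*} [Fintype ι] (f : (ι → ℝ) → ℝ≥0∞) (hf : Measurable f)
    {t : ℝ} (ht : 0 < t) :
    ENNReal.ofReal (t ^ Fintype.card ι) * ∫⁻ φ, f (t • φ) = ∫⁻ φ, f φ := by
  have h := Measure.map_addHaar_smul (volume : Measure (ι → ℝ)) ht.ne'
  rw [← lintegral_map hf (measurable_const_smul t), h, lintegral_smul_measure, smul_eq_mul,
    ← mul_assoc, ← ENNReal.ofReal_mul (by positivity)]
  have : t ^ Fintype.card ι * |(t ^ Module.finrank ℝ (ι → ℝ))⁻¹| = 1 := by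
    rw [Module.finrank_fintype_fun_eq_card, abs_of_pos (by positivity)]
    field_simp
  rw [this]; simp

theorem lintegral_exp_neg_ne_top {ι : Type*} [Fintype ι] {D : (ι → ℝ) → ℝ} {c : ℝ} (hc : 0 < c)
    (hD : ∀ φ, c * ∑ i, φ i ^ 2 ≤ D φ) :
    ∫⁻ φ, ENNReal.ofReal (Real.exp (-D φ)) ≠ ⊤ := by
  have hint : Integrable (fun φ : ι → ℝ => ∏ i, Real.exp (-c * φ i ^ 2)) :=
    Integrable.fintype_prod fun _ => integrable_exp_neg_mul_sq hc
  refine ne_top_of_le_ne_top hint.lintegral_lt_top.ne (lintegral_mono fun φ => ?_)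
  refine ENNReal.ofReal_le_ofReal ?_
  rw [← Real.exp_sum, ← Finset.mul_sum]
  exact Real.exp_le_exp.2 (by linarith [hD φ])

theorem lintegral_ofReal_exp_ne_zero {ι : Type*} [Fintype ι] {h : (ι → ℝ) → ℝ}
    (hh : Measurable h) : ∫⁻ φ, ENNReal.ofReal (Real.exp (-h φ)) ≠ 0 := by
  intro h0
  rw [lintegral_eq_zero_iff (by fun_prop)] at h0
  obtain ⟨φ, hφ⟩ := h0.exists
  simp [(Real.exp_pos _).not_ge] at hφ

/-- A linear perturbation does not decrease the partition function of a quadratic form. -/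
theorem lintegral_exp_neg_le_lintegral_exp_neg_add {ι : Type*} [Fintype ι] {q l : (ι → ℝ) → ℝ}
    (hq : Measurable q) (hl : Measurable l) (hq_even : ∀ φ, q (-φ) = q φ)
    (hl_odd : ∀ φ, l (-φ) = -l φ) :
    ∫⁻ φ, ENNReal.ofReal (Real.exp (-q φ)) ≤ ∫⁻ φ, ENNReal.ofReal (Real.exp (-(l φ + q φ))) := by
  set I := ∫⁻ φ, ENNReal.ofReal (Real.exp (-(l φ + q φ))) with hI
  -- Reflecting `φ` leaves the integral unchanged; averaging both forms leaves the factor `cosh l ≥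
  -- 1`.
  have h1 : ∫⁻ φ, ENNReal.ofReal (Real.exp (-(-l φ + q φ))) = I := by
    rw [hI, ← (Measure.measurePreserving_neg (volume : Measure (ι → ℝ))).lintegral_comp
      (by fun_prop)]
    simp only [hq_even, hl_odd, neg_neg]
  have h2 : 2 * ∫⁻ φ, ENNReal.ofReal (Real.exp (-q φ)) ≤ 2 * I := by
    rw [two_mul I]
    nth_rewrite 2 [← h1]
    rw [hI, ← lintegral_add_left (by fun_prop), ← lintegral_const_mul _ (by fun_prop)]
    refine lintegral_mono fun φ => ?_
    rw [← ENNReal.ofReal_add (by positivity) (by positivity),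
      ← ENNReal.ofReal_ofNat 2, ← ENNReal.ofReal_mul (by norm_num)]
    refine ENNReal.ofReal_le_ofReal ?_
    have e1 : Real.exp (-(l φ + q φ)) = Real.exp (-l φ) * Real.exp (-q φ) := by
      rw [← Real.exp_add]; ring_nf
    have e2 : Real.exp (-(-l φ + q φ)) = Real.exp (l φ) * Real.exp (-q φ) := by
      rw [← Real.exp_add]; ring_nf
    rw [e1, e2]
    have := Real.add_one_le_exp (l φ)
    have := Real.add_one_le_exp (-l φ)
    nlinarith [Real.exp_pos (-q φ)]
  exact (ENNReal.mul_le_mul_iff_right (by norm_num) (by norm_num)).1 h2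

/-- The energy estimate: comparison of a Gibbs weight with Gaussian weights bounds the mean of the
quadratic form. -/
theorem lintegral_energy_le {ι : Type*} [Fintype ι] {h D l : (ι → ℝ) → ℝ} {a t k R R' : ℝ}
    (hh : Measurable h) (hD : Measurable D) (hl : Measurable l) (hD0 : ∀ φ, 0 ≤ D φ)
    (hDs : ∀ (s : ℝ) φ, D (s • φ) = s ^ 2 * D φ) (hl_odd : ∀ φ, l (-φ) = -l φ)
    (ha : 0 < a) (ht : 0 < t) (hlow : ∀ φ, k + 2 * a * D φ - R ≤ h φ)
    (hup : ∀ φ, h φ ≤ k + l φ + a * t ^ 2 * D φ + R')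
    (hfin : ∫⁻ φ, ENNReal.ofReal (Real.exp (-(a * D φ))) ≠ ⊤) :
    ∫⁻ φ, ENNReal.ofReal (Real.exp (-h φ)) ≠ ⊤ ∧
    ∫⁻ φ, ENNReal.ofReal (Real.exp (-h φ)) * ENNReal.ofReal (a * D φ) ≤
      (ENNReal.ofReal (R + R' + Fintype.card ι * t) + 1) *
        ∫⁻ φ, ENNReal.ofReal (Real.exp (-h φ)) := by
  set Z := ∫⁻ φ, ENNReal.ofReal (Real.exp (-h φ)) with hZ
  set G := ∫⁻ φ, ENNReal.ofReal (Real.exp (-(a * D φ))) with hG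
  set c : ℝ := R + R' + Fintype.card ι * t with hc
  have hnum : ∫⁻ φ, ENNReal.ofReal (Real.exp (a * D φ - h φ)) ≤
      ENNReal.ofReal (Real.exp (R - k)) * G := by
    rw [hG, ← lintegral_const_mul _ (by fun_prop)]
    refine lintegral_mono fun φ => ?_
    rw [← ENNReal.ofReal_mul (by positivity), ← Real.exp_add]
    exact ENNReal.ofReal_le_ofReal (Real.exp_le_exp.2 (by linarith [hlow φ]))
  have hden : G ≤ ENNReal.ofReal (t ^ Fintype.card ι) *
      (ENNReal.ofReal (Real.exp (k + R')) * Z) := by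
    rw [hG, ← lintegral_comp_smul_pi _ (by fun_prop) ht]
    gcongr
    simp only [hDs]
    refine (lintegral_exp_neg_le_lintegral_exp_neg_add (by fun_prop) hl (fun φ => ?_)
      hl_odd).trans ?_
    · have := hDs (-1) φ
      simp only [neg_smul, one_smul] at this
      rw [this]; norm_num
    · rw [hZ, ← lintegral_const_mul _ (by fun_prop)]
      refine lintegral_mono fun φ => ?_
      rw [← ENNReal.ofReal_mul (by positivity), ← Real.exp_add]
      exact ENNReal.ofReal_le_ofReal (Real.exp_le_exp.2 (by linarith [hup φ]))
  have hexp : ∫⁻ φ, ENNReal.ofReal (Real.exp (a * D φ - h φ)) ≤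
      ENNReal.ofReal (Real.exp c) * Z := by
    refine hnum.trans ((mul_le_mul_right hden _).trans ?_)
    rw [← mul_assoc, ← mul_assoc, ← ENNReal.ofReal_mul (by positivity),
      ← ENNReal.ofReal_mul (by positivity)]
    gcongr
    -- The crude `t ≤ exp t` suffices: the Jacobian of the scaling costs only `t` per site.
    have h1 : t ^ Fintype.card ι ≤ Real.exp (Fintype.card ι * t) := by
      rw [Real.exp_nat_mul]
      gcongr
      linarith [Real.add_one_le_exp t]
    calc Real.exp (R - k) * t ^ Fintype.card ι * Real.exp (k + R')
        ≤ Real.exp (R - k) * Real.exp (Fintype.card ι * t) * Real.exp (k + R') := by gcongr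
      _ = Real.exp c := by rw [← Real.exp_add, ← Real.exp_add, hc]; ring_nf
  constructor
  · refine ne_top_of_le_ne_top (ENNReal.mul_ne_top ENNReal.ofReal_ne_top hfin)
      (le_trans (lintegral_mono fun φ => ?_) hnum)
    refine ENNReal.ofReal_le_ofReal (Real.exp_le_exp.2 ?_)
    linarith [mul_nonneg ha.le (hD0 φ)]
  · calc ∫⁻ φ, ENNReal.ofReal (Real.exp (-h φ)) * ENNReal.ofReal (a * D φ)
        ≤ ∫⁻ φ, (ENNReal.ofReal c * ENNReal.ofReal (Real.exp (-h φ)) +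
            ENNReal.ofReal (Real.exp (-c)) * ENNReal.ofReal (Real.exp (a * D φ - h φ))) := by
          refine lintegral_mono fun φ => ?_
          rw [← ENNReal.ofReal_mul (Real.exp_nonneg (-h φ)),
            ← ENNReal.ofReal_mul' (Real.exp_nonneg (-h φ)),
            ← ENNReal.ofReal_mul (Real.exp_nonneg (-c))]
          refine le_trans (ENNReal.ofReal_le_ofReal ?_) ENNReal.ofReal_add_le
          -- This is `x ≤ c + exp (x - c)` with `x = a D`, which passes from the exponential moment
          -- to the mean at the cost of 1.
          have h1 := Real.add_one_le_exp (a * D φ - c)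
          have h2 : Real.exp (-c) * Real.exp (a * D φ - h φ) =
              Real.exp (a * D φ - c) * Real.exp (-h φ) := by
            rw [← Real.exp_add, ← Real.exp_add]; ring_nf
          rw [h2]
          nlinarith [Real.exp_pos (-h φ)]
      _ = ENNReal.ofReal c * Z +
            ENNReal.ofReal (Real.exp (-c)) * ∫⁻ φ, ENNReal.ofReal (Real.exp (a * D φ - h φ)) := by
          rw [lintegral_add_left (by fun_prop), lintegral_const_mul _ (by fun_prop),
            lintegral_const_mul _ (by fun_prop)]
      _ ≤ ENNReal.ofReal c * Z +
            ENNReal.ofReal (Real.exp (-c)) * (ENNReal.ofReal (Real.exp c) * Z) := by gcongr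
      _ = _ := by
          rw [← mul_assoc, ← ENNReal.ofReal_mul (by positivity), ← Real.exp_add]
          simp [add_mul]

/-! ### Tilts, measurability and integrals under the Gibbs measure -/

theorem tilt_add {d : ℕ} (u : Fin d → ℝ) (x v : Site d) :
    tilt u (x + v) = tilt u x + tilt u v := by
  simp [tilt, mul_add, Finset.sum_add_distrib]

theorem tilt_sub {d : ℕ} (u : Fin d → ℝ) (x v : Site d) :
    tilt u (x - v) = tilt u x - tilt u v := by
  simp [tilt, mul_sub]

theorem abs_tilt_sub_le {d : ℕ} (u : Fin d → ℝ) {x y : Site d} (h : dist1 x y = 1) :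
    |tilt u x - tilt u y| ≤ ∑ i, |u i| := by
  rw [← tilt_sub]
  refine (Finset.abs_sum_le_sum_abs _ _).trans (Finset.sum_le_sum fun i _ => ?_)
  rw [abs_mul]
  refine mul_le_of_le_one_right (abs_nonneg _) ?_
  have : |x i - y i| ≤ 1 := h ▸ Finset.single_le_sum (f := fun j => |x j - y j|)
    (fun j _ => abs_nonneg _) (Finset.mem_univ i)
  simp only [Pi.sub_apply]
  exact_mod_cast this

theorem measurable_pairPotential {d : ℕ} {α : Type*} [MeasurableSpace α] {W : α → Bond d → ℝ → ℝ}
    (hW : ∀ b, Measurable fun p : α × ℝ => W p.1 b p.2) (x y : Site d) :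
    Measurable fun p : α × ℝ => pairPotential (W p.1) x y p.2 := by
  unfold pairPotential
  by_cases h : dist1 x y = 1
  · simpa [h] using hW ⟨(x, y), h⟩
  · simp [h]

theorem measurable_hamiltonian {d : ℕ} {α : Type*} [MeasurableSpace α] {W : α → Bond d → ℝ → ℝ}
    {ξ : α → Site d → ℝ} (hW : ∀ b, Measurable fun p : α × ℝ => W p.1 b p.2)
    (hξ : ∀ x, Measurable fun a => ξ a x) (Λ : Finset (Site d)) (ψ : Site d → ℝ) :
    Measurable fun p : α × (Site d → ℝ) => hamiltonian (W p.1) (ξ p.1) Λ ψ p.2 := by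
  have hpot : ∀ (x y : Site d) (s : (Site d → ℝ) → ℝ), Measurable s →
      Measurable fun p : α × (Site d → ℝ) => pairPotential (W p.1) x y (s p.2) := fun x y s hs =>
    (measurable_pairPotential hW x y).comp
      (measurable_fst.prodMk (hs.comp measurable_snd))
  unfold hamiltonian hamiltonianB
  have h1 : ∀ x y, Measurable fun p : α × (Site d → ℝ) =>
      if h : dist1 x y = 1 then W p.1 ⟨(x, y), h⟩ (p.2 x - p.2 y) else 0 := fun x y =>
    hpot x y (fun φ => φ x - φ y) (by fun_prop)
  have h2 : ∀ x y, Measurable fun p : α × (Site d → ℝ) =>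
      if h : dist1 x y = 1 then W p.1 ⟨(x, y), h⟩ (p.2 x - ψ y) else 0 := fun x y =>
    hpot x y (fun φ => φ x - ψ y) (by fun_prop)
  have h3 : ∀ x, Measurable fun p : α × (Site d → ℝ) => ξ p.1 x * p.2 x := fun x =>
    ((hξ x).comp measurable_fst).mul (by fun_prop)
  refine ((Measurable.const_mul ?_ _).add ?_).add (Measurable.const_mul ?_ _)
  · exact Finset.measurable_sum _ fun x _ => Finset.measurable_sum _ fun y _ => h1 x y
  · exact Finset.measurable_sum _ fun x _ => Finset.measurable_sum _ fun y _ => h2 x y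
  · exact Finset.measurable_sum _ fun x _ => h3 x

theorem measurable_hamiltonian_right {d : ℕ} {W : Bond d → ℝ → ℝ} (hW : ∀ b, Measurable (W b))
    (ξ : Site d → ℝ) (Λ : Finset (Site d)) (ψ : Site d → ℝ) :
    Measurable (hamiltonian W ξ Λ ψ) := by
  have h := measurable_hamiltonian (α := Unit) (W := fun _ => W) (ξ := fun _ => ξ)
    (fun b => by fun_prop) (fun x => by fun_prop) Λ ψ
  have h2 : Measurable fun φ : Site d → ℝ => hamiltonian W ξ Λ ψ (((), φ) : Unit × _).2 :=
    h.comp (measurable_prodMk_left (x := ()))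
  exact h2

/-- Lebesgue measure is translation invariant, so the heights can be recentred at `ψ`; the
integration then runs over fields that vanish off `Λ`. -/
theorem lintegral_unnormalizedGibbs {d : ℕ} {H : (Site d → ℝ) → ℝ} (hH : Measurable H)
    (Λ : Finset (Site d)) (ψ : Site d → ℝ) {F : (Site d → ℝ) → ℝ≥0∞} (hF : Measurable F) :
    ∫⁻ φ, F φ ∂(unnormalizedGibbs H Λ ψ) =
      ∫⁻ φ : Λ → ℝ, ENNReal.ofReal (Real.exp (-H (ψ + glue Λ 0 φ))) * F (ψ + glue Λ 0 φ) := by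
  have hg := measurable_glue Λ ψ
  unfold unnormalizedGibbs
  rw [lintegral_map hF hg, lintegral_withDensity_eq_lintegral_mul _ (by fun_prop) (by fun_prop),
    ← lintegral_add_right_eq_self _ (fun x : Λ => ψ x)]
  simp only [Pi.mul_apply, glue_add]

theorem unnormalizedGibbs_univ {d : ℕ} {H : (Site d → ℝ) → ℝ} (hH : Measurable H)
    (Λ : Finset (Site d)) (ψ : Site d → ℝ) :
    unnormalizedGibbs H Λ ψ Set.univ =
      ∫⁻ φ : Λ → ℝ, ENNReal.ofReal (Real.exp (-H (ψ + glue Λ 0 φ))) := by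
  rw [← lintegral_one, lintegral_unnormalizedGibbs hH _ _ measurable_const]
  simp

theorem lintegral_gibbs {d : ℕ} {H : (Site d → ℝ) → ℝ} (hH : Measurable H)
    (Λ : Finset (Site d)) (ψ : Site d → ℝ) {F : (Site d → ℝ) → ℝ≥0∞} (hF : Measurable F) :
    ∫⁻ φ, F φ ∂(gibbs H Λ ψ) =
      (∫⁻ φ : Λ → ℝ, ENNReal.ofReal (Real.exp (-H (ψ + glue Λ 0 φ))))⁻¹ *
      ∫⁻ φ : Λ → ℝ, ENNReal.ofReal (Real.exp (-H (ψ + glue Λ 0 φ))) * F (ψ + glue Λ 0 φ) := by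
  rw [gibbs, lintegral_smul_measure, lintegral_unnormalizedGibbs hH _ _ hF,
    unnormalizedGibbs_univ hH, smul_eq_mul]

theorem lintegral_gradGibbs {d : ℕ} {H : (Site d → ℝ) → ℝ} (Λ : Finset (Site d))
    (ψ : Site d → ℝ) {F : GradField d → ℝ≥0∞} (hF : Measurable F) :
    ∫⁻ η, F η ∂(gradGibbs H Λ ψ) = ∫⁻ φ, F (grad φ) ∂(gibbs H Λ ψ) :=
  lintegral_map hF continuous_grad.measurable

theorem pairPotential_of_eq {d : ℕ} (W : Bond d → ℝ → ℝ) {x y : Site d} (h : dist1 x y = 1)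
    (s : ℝ) : pairPotential W x y s = W ⟨(x, y), h⟩ s := by simp [pairPotential, h]

/-! ### Energy estimate in a fixed box and a fixed environment -/

/-- The sum of a bond function over the directed bonds that issue from a site of `Λ`. -/
noncomputable def bondSum {d : ℕ} (Λ : Finset (Site d)) (β : Bond d → ℝ) : ℝ :=
  ∑ x ∈ Λ, ∑ y ∈ neighbors x, pairPotential (fun b _ => β b) x y 0

theorem bondSum_nonneg {d : ℕ} (Λ : Finset (Site d)) {β : Bond d → ℝ} (hβ : ∀ b, 0 ≤ β b) :
    0 ≤ bondSum Λ β := by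
  refine Finset.sum_nonneg fun x _ => Finset.sum_nonneg fun y hy => ?_
  rw [pairPotential_of_eq _ (mem_neighbors.1 hy)]
  exact hβ _

/-- A constant per site in the energy estimate. -/
noncomputable def energyConst (d : ℕ) (u : Fin d → ℝ) (A C : ℝ) : ℝ :=
  3 ^ d * ((A + 2 * C) * (∑ i, |u i|) ^ 2) + √(32 * C / A)

/-- Bond by bond, with tilt difference `τ` and gradient `s`: `s²/2 - τ² ≤ (τ + s)² ≤ 2s² + 2τ²`. The
weight 1/2 of interior bonds turns `A/2` into `A/4`. -/
theorem hamiltonianB_tilt_bounds {d : ℕ} (u : Fin d → ℝ) {W : Bond d → ℝ → ℝ} {β : Bond d → ℝ}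
    {A C : ℝ} (hA : 0 < A) (hC : 0 < C) (hβ : ∀ b, 0 ≤ β b)
    (hW : ∀ b s, A * s ^ 2 - β b ≤ W b s ∧ W b s ≤ C * s ^ 2 + β b) (Λ : Finset (Site d))
    {φ : Site d → ℝ} (hφ : ∀ x ∉ Λ, φ x = 0) :
    A / 4 * dirichlet Λ φ - (Λ.card * (3 ^ d * (A * (∑ i, |u i|) ^ 2)) + bondSum Λ β) ≤
        hamiltonianB W Λ (tilt u) (tilt u + φ) ∧
      hamiltonianB W Λ (tilt u) (tilt u + φ) ≤
        2 * C * dirichlet Λ φ + (Λ.card * (3 ^ d * (2 * C * (∑ i, |u i|) ^ 2)) + bondSum Λ β) := by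
  set T := (∑ i, |u i|) ^ 2 with hT
  have hT0 : 0 ≤ T := sq_nonneg _
  rw [hamiltonianB_eq_sum W Λ (fun x hx => by simp [hφ x hx])]
  have hterm : ∀ x, ∀ y ∈ neighbors x,
      A / 4 * (φ x - φ y) ^ 2 - (A * T + pairPotential (fun b _ => β b) x y 0) ≤
        bondWeight Λ y * pairPotential W x y ((tilt u + φ) x - (tilt u + φ) y) ∧
      bondWeight Λ y * pairPotential W x y ((tilt u + φ) x - (tilt u + φ) y) ≤
        2 * C * (φ x - φ y) ^ 2 + (2 * C * T + pairPotential (fun b _ => β b) x y 0) := by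
    intro x y hy
    have h := mem_neighbors.1 hy
    simp only [pairPotential_of_eq _ h]
    have hw := bondWeight_bounds Λ y
    obtain ⟨h1, h2⟩ := hW ⟨(x, y), h⟩ ((tilt u + φ) x - (tilt u + φ) y)
    have hb := hβ ⟨(x, y), h⟩
    set w := bondWeight Λ y
    set v := W ⟨(x, y), h⟩ ((tilt u + φ) x - (tilt u + φ) y)
    set b := β ⟨(x, y), h⟩
    have hτ : (tilt u x - tilt u y) ^ 2 ≤ T := by
      rw [hT, ← sq_abs]
      have := abs_tilt_sub_le u h
      gcongr
    have hs : (tilt u + φ) x - (tilt u + φ) y = (tilt u x - tilt u y) + (φ x - φ y) := by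
      simp only [Pi.add_apply]; ring
    rw [hs] at h1 h2
    set τ := tilt u x - tilt u y
    set s := φ x - φ y
    have g1 : A * (s ^ 2 / 2 - T) ≤ A * (τ + s) ^ 2 :=
      mul_le_mul_of_nonneg_left (by nlinarith [sq_nonneg (2 * τ + s)]) hA.le
    have g2 : C * (τ + s) ^ 2 ≤ C * (2 * s ^ 2 + 2 * T) :=
      mul_le_mul_of_nonneg_left (by nlinarith [sq_nonneg (τ - s)]) hC.le
    have p1 : 0 ≤ A * s ^ 2 := by positivity
    have p2 : 0 ≤ A * T := by positivity
    have p3 : 0 ≤ C * s ^ 2 := by positivity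
    have p4 : 0 ≤ C * T := by positivity
    have hw0 : 0 ≤ w := by linarith
    constructor
    · calc A / 4 * s ^ 2 - (A * T + b) ≤ w * (A * s ^ 2 / 2) - w * (A * T + b) := by
            nlinarith
        _ ≤ w * v := by
            rw [← mul_sub]; exact mul_le_mul_of_nonneg_left (by linarith) hw0
    · calc w * v ≤ w * (2 * C * s ^ 2 + (2 * C * T + b)) :=
            mul_le_mul_of_nonneg_left (by linarith) hw0
        _ ≤ _ := mul_le_of_le_one_left (by positivity) hw.2
  have hcard : ∀ c : ℝ, 0 ≤ c → ∑ x ∈ Λ, ∑ _y ∈ neighbors x, c ≤ Λ.card * (3 ^ d * c) := by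
    intro c hc
    refine (Finset.sum_le_sum (g := fun _ => 3 ^ d * c) fun x _ => ?_).trans (by simp)
    rw [Finset.sum_const, nsmul_eq_mul]
    have := card_neighbors_le x
    gcongr
    exact_mod_cast this
  have e1 := hcard (A * T) (by positivity)
  have e2 := hcard (2 * C * T) (by positivity)
  simp only [← Finset.mul_sum] at e1 e2
  constructor
  · refine le_trans ?_ (Finset.sum_le_sum fun x _ => Finset.sum_le_sum fun y hy =>
      (hterm x y hy).1)
    simp only [Finset.sum_sub_distrib, Finset.sum_add_distrib, ← Finset.mul_sum]
    unfold dirichlet bondSum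
    linarith
  · refine le_trans (Finset.sum_le_sum fun x _ => Finset.sum_le_sum fun y hy =>
      (hterm x y hy).2) ?_
    simp only [Finset.sum_add_distrib, ← Finset.mul_sum]
    unfold dirichlet bondSum
    linarith

/-- The partition function is finite, and the mean Dirichlet energy of `φ - ψ_u` is bounded by a
multiple of the volume and sums of the disorder variables. -/
theorem gibbs_dirichlet_le {d : ℕ} (hd : 1 ≤ d) (u : Fin d → ℝ) {W : Bond d → ℝ → ℝ}
    {ξ : Site d → ℝ} {β : Bond d → ℝ} {A C Q : ℝ} (hA : 0 < A) (hC : 0 < C) (hβ : ∀ b, 0 ≤ β b)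
    (hWm : ∀ b, Measurable (W b))
    (hW : ∀ b s, A * s ^ 2 - β b ≤ W b s ∧ W b s ≤ C * s ^ 2 + β b) (Λ : Finset (Site d))
    (hQ : ∀ φ : Site d → ℝ, (∀ x ∉ Λ, φ x = 0) →
      -(A / 8 * dirichlet Λ φ) - Q ≤ (1 / 2) * ∑ x ∈ Λ, ξ x * φ x) :
    unnormalizedGibbs (hamiltonian W ξ Λ (tilt u)) Λ (tilt u) Set.univ ≠ 0 ∧
    unnormalizedGibbs (hamiltonian W ξ Λ (tilt u)) Λ (tilt u) Set.univ ≠ ⊤ ∧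
    ∫⁻ φ, ENNReal.ofReal (A / 16 * dirichlet Λ (φ - tilt u))
        ∂(gibbs (hamiltonian W ξ Λ (tilt u)) Λ (tilt u)) ≤
      ENNReal.ofReal (Λ.card * energyConst d u A C + 2 * bondSum Λ β + Q) + 1 := by
  have hHm := measurable_hamiltonian_right hWm ξ Λ (tilt u)
  have hg := measurable_glue Λ (0 : Site d → ℝ)
  have hdm := measurable_dirichlet Λ
  set h : (Λ → ℝ) → ℝ := fun φ => hamiltonian W ξ Λ (tilt u) (tilt u + glue Λ 0 φ) with hh
  have hhm : Measurable h := by fun_prop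
  have hoff : ∀ (φ : Λ → ℝ), ∀ x ∉ Λ, glue Λ 0 φ x = 0 := fun φ x hx => glue_of_notMem hx
  have hbd := fun φ : Λ → ℝ => hamiltonianB_tilt_bounds u hA hC hβ hW Λ (hoff φ)
  set k : ℝ := (1 / 2) * ∑ x ∈ Λ, ξ x * tilt u x with hk
  set l : (Λ → ℝ) → ℝ := fun φ => (1 / 2) * ∑ x ∈ Λ, ξ x * glue Λ 0 φ x with hl
  have hlm : Measurable l := by
    refine Measurable.const_mul (Finset.measurable_sum _ fun x _ => Measurable.const_mul ?_ _) _
    exact (measurable_pi_apply x).comp hg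
  have hdec : ∀ φ : Λ → ℝ,
      h φ = hamiltonianB W Λ (tilt u) (tilt u + glue Λ 0 φ) + k + l φ := by
    intro φ
    simp only [hh, hamiltonian, hk, hl, Pi.add_apply, mul_add, Finset.sum_add_distrib]
    ring
  obtain ⟨c, hc, hcD⟩ := exists_sum_sq_le_dirichlet hd Λ
  -- With `a = A/16`, the lower coefficient `2a = A/8` is what remains of `A/4` after the field has
  -- taken `A/8`, and `t` is chosen so that `a t² = 2C`.
  have ht : 0 < √(32 * C / A) := Real.sqrt_pos.2 (by positivity)
  have hmain := lintegral_energy_le (h := h) (D := fun φ => dirichlet Λ (glue Λ 0 φ)) (l := l)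
    (a := A / 16) (t := √(32 * C / A)) (k := k)
    (R := Λ.card * (3 ^ d * (A * (∑ i, |u i|) ^ 2)) + bondSum Λ β + Q)
    (R' := Λ.card * (3 ^ d * (2 * C * (∑ i, |u i|) ^ 2)) + bondSum Λ β)
    hhm (by fun_prop) hlm (fun φ => dirichlet_nonneg _ _)
    (fun s φ => by rw [glue_zero_smul, dirichlet_smul])
    (fun φ => by
      have : -φ = (-1 : ℝ) • φ := by simp
      simp only [hl, this, glue_zero_smul]
      simp)
    (by positivity) ht
    (fun φ => by
      have h1 := (hbd φ).1
      have h2 := hQ _ (hoff φ)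
      rw [hdec]
      simp only [hl]
      linarith)
    (fun φ => by
      have h1 := (hbd φ).2
      rw [hdec, Real.sq_sqrt (by positivity)]
      have : A / 16 * (32 * C / A) = 2 * C := by field_simp; norm_num
      rw [this]
      linarith)
    (lintegral_exp_neg_ne_top (c := A / 16 * c) (by positivity) fun φ => by
      have h1 := hcD _ (hoff φ)
      rw [mul_assoc]
      refine mul_le_mul_of_nonneg_left (le_trans (le_of_eq ?_) h1) (by positivity)
      rw [← Finset.sum_coe_sort Λ]
      simp only [glue_of_mem (Subtype.coe_prop _)])
  have hZ := unnormalizedGibbs_univ hHm Λ (tilt u)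
  have hZ0 := lintegral_ofReal_exp_ne_zero hhm
  refine ⟨hZ ▸ hZ0, hZ ▸ hmain.1, ?_⟩
  rw [lintegral_gibbs hHm _ _ (by fun_prop), mul_comm]
  simp only [add_sub_cancel_left]
  refine (mul_le_mul_left hmain.2 _).trans ?_
  rw [mul_assoc, ENNReal.mul_inv_cancel hZ0 hmain.1, mul_one]
  refine add_le_add_left (ENNReal.ofReal_le_ofReal (le_of_eq ?_)) _
  rw [Fintype.card_coe, energyConst]
  ring

/-! ### A flow of finite energy from the origin of `ℕ³` to infinity -/

/-- The points of `ℕ³` at distance `n` from the origin. -/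
def level (n : ℕ) : Finset (Fin 3 → ℕ) := Finset.piAntidiag Finset.univ n

theorem mem_level {n : ℕ} {v : Fin 3 → ℕ} : v ∈ level n ↔ ∑ i, v i = n := by
  simp [level, Finset.mem_piAntidiag]

/-- Double counting: on level `n + 1` the coordinates of `w` sum to `n + 1`, and each positive one
comes from a predecessor `w - e_i`. -/
theorem sum_level_succ (n : ℕ) (g : (Fin 3 → ℕ) → ℝ) :
    (n + 1) * ∑ w ∈ level (n + 1), g w =
      ∑ v ∈ level n, ∑ i, (v i + 1) * g (v + Pi.single i 1) := by
  have h1 : (n + 1) * ∑ w ∈ level (n + 1), g w = ∑ w ∈ level (n + 1), ∑ i, (w i : ℝ) * g w := by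
    rw [Finset.mul_sum]
    refine Finset.sum_congr rfl fun w hw => ?_
    rw [← Finset.sum_mul, ← Nat.cast_sum, mem_level.1 hw]
    push_cast; rfl
  rw [h1, Finset.sum_comm, Finset.sum_comm (s := level n)]
  refine Finset.sum_congr rfl fun i _ => Eq.symm ?_
  refine Finset.sum_of_injOn (fun v => v + Pi.single i 1) (fun _ _ _ _ h => add_right_cancel h)
    ?_ ?_ ?_
  · intro v hv
    have := mem_level.1 (Finset.mem_coe.1 hv)
    exact Finset.mem_coe.2 (mem_level.2 (by simp [Finset.sum_add_distrib, this]))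
  · intro w hw hw'
    rcases Nat.eq_zero_or_pos (w i) with h | h
    · simp [h]
    · have hle : Pi.single i 1 ≤ w := by
        intro j
        by_cases hj : j = i
        · subst hj; simpa using Nat.succ_le_of_lt h
        · simp [hj]
      refine absurd ⟨w - Pi.single i 1, ?_, tsub_add_cancel_of_le hle⟩ hw'
      refine Finset.mem_coe.2 (mem_level.2 ?_)
      have h2 := mem_level.1 hw
      rw [← tsub_add_cancel_of_le hle] at h2
      simpa [Finset.sum_add_distrib] using h2
  · intro v _
    simp

/-- The flow through the bond from `v` to `v + e_i` of the Pólya urn with three colours: a unit flow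
from the origin of `ℕ³` to infinity with finite energy. -/
noncomputable def polyaFlow (v : Fin 3 → ℕ) (i : Fin 3) : ℝ :=
  2 / (((∑ j, v j : ℕ) + 1) * ((∑ j, v j : ℕ) + 2)) * ((v i + 1) / ((∑ j, v j : ℕ) + 3))

/-- The urn carries the uniform law of a level to that of the next, so pairing the flow with a
gradient gives a difference of level means, which telescopes. -/
theorem sum_polyaFlow_level (n : ℕ) (g : (Fin 3 → ℕ) → ℝ) :
    ∑ v ∈ level n, ∑ i, polyaFlow v i * (g v - g (v + Pi.single i 1)) =
      2 / ((n + 1) * (n + 2)) * ∑ v ∈ level n, g v -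
        2 / ((n + 1 + 1) * (n + 1 + 2)) * ∑ v ∈ level (n + 1), g v := by
  have h1 := sum_level_succ n g
  have hn : (n + 1 : ℝ) ≠ 0 := by positivity
  have h2 : ∑ v ∈ level (n + 1), g v =
      (n + 1 : ℝ)⁻¹ * ∑ v ∈ level n, ∑ i, (v i + 1) * g (v + Pi.single i 1) := by
    rw [← h1, inv_mul_cancel_left₀ hn]
  rw [h2, Finset.mul_sum, Finset.mul_sum, Finset.mul_sum, ← Finset.sum_sub_distrib]
  refine Finset.sum_congr rfl fun v hv => ?_
  have hv' := mem_level.1 hv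
  have hv3 : (v 0 + v 1 + v 2 : ℝ) = n := by
    rw [← hv', Fin.sum_univ_three]; push_cast; rfl
  simp only [polyaFlow, hv', Fin.sum_univ_three]
  field_simp
  rw [← hv3]
  ring

theorem card_level_mul (n : ℕ) : 2 / ((n + 1) * (n + 2) : ℝ) * (level n).card = 1 := by
  induction n with
  | zero =>
    have : level 0 = {0} := by
      ext v; simp [mem_level, funext_iff]
    simp [this]
  | succ n ih =>
    -- A constant has no gradient, so consecutive levels have equal mass.
    have h := sum_polyaFlow_level n fun _ => 1
    simp only [sub_self, mul_zero, Finset.sum_const_zero, Finset.sum_const, nsmul_eq_mul, mul_one]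
      at h
    push_cast
    linarith

/-- The points of `ℕ³` at distance less than `M` from the origin. -/
def simplex (M : ℕ) : Finset (Fin 3 → ℕ) := (Finset.range M).biUnion level

theorem sum_simplex (M : ℕ) (f : (Fin 3 → ℕ) → ℝ) :
    ∑ v ∈ simplex M, f v = ∑ n ∈ Finset.range M, ∑ v ∈ level n, f v := by
  refine Finset.sum_biUnion fun m _ n _ hmn => ?_
  rw [Function.onFun, Finset.disjoint_left]
  intro v hm hn
  exact hmn ((mem_level.1 hm).symm.trans (mem_level.1 hn))

theorem sum_polyaFlow_simplex (M : ℕ) (g : (Fin 3 → ℕ) → ℝ) (hg : ∀ v ∈ level M, g v = 0) :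
    ∑ v ∈ simplex M, ∑ i, polyaFlow v i * (g v - g (v + Pi.single i 1)) = g 0 := by
  rw [sum_simplex]
  simp only [sum_polyaFlow_level]
  have := Finset.sum_range_sub'
    (fun n : ℕ => 2 / ((n + 1) * (n + 2) : ℝ) * ∑ v ∈ level n, g v) M
  push_cast at this
  rw [this, Finset.sum_eq_zero hg]
  have : level 0 = {0} := by
    ext v; simp [mem_level, funext_iff]
  simp [this]

/-- The outflow of a vertex on level `n` is `p = 2 / ((n+1)(n+2))`, the inverse of the number of
such vertices, so the level has energy at most `p`, and these bounds telescope. With two colours the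
same bound would be `1 / (n+1)`, which is not summable. -/
theorem sum_polyaFlow_sq_le (M : ℕ) : ∑ v ∈ simplex M, ∑ i, polyaFlow v i ^ 2 ≤ 2 := by
  have hlevel : ∀ n, ∑ v ∈ level n, ∑ i, polyaFlow v i ^ 2 ≤ 2 / ((n + 1 : ℝ) * (n + 2)) := by
    intro n
    set p : ℝ := 2 / ((n + 1 : ℝ) * (n + 2)) with hp
    have hp0 : 0 < p := by positivity
    have hv : ∀ v ∈ level n, ∑ i, polyaFlow v i ^ 2 ≤ p ^ 2 := by
      intro v hv
      have hv' := mem_level.1 hv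
      have hv3 : (v 0 + v 1 + v 2 : ℝ) = n := by
        rw [← hv', Fin.sum_univ_three]; push_cast; rfl
      have h0 : ∀ i, 0 ≤ polyaFlow v i := fun i => by unfold polyaFlow; positivity
      have h1 : ∑ i, polyaFlow v i = p := by
        simp only [polyaFlow, hv', Fin.sum_univ_three, hp]
        field_simp
        linarith
      rw [← h1]
      exact Finset.sum_sq_le_sq_sum_of_nonneg fun i _ => h0 i
    refine (Finset.sum_le_sum hv).trans (le_of_eq ?_)
    rw [Finset.sum_const, nsmul_eq_mul]
    have := card_level_mul n
    rw [← hp] at this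
    calc ((level n).card : ℝ) * p ^ 2 = (p * (level n).card) * p := by ring
      _ = p := by rw [this, one_mul]
  rw [sum_simplex]
  refine (Finset.sum_le_sum fun n _ => hlevel n).trans ?_
  have h := Finset.sum_range_sub' (fun n : ℕ => 2 / (n + 1 : ℝ)) M
  have h' : ∀ n : ℕ, 2 / (n + 1 : ℝ) - 2 / ((n + 1 : ℕ) + 1 : ℝ) = 2 / ((n + 1 : ℝ) * (n + 2)) := by
    intro n; push_cast; field_simp; ring
  simp only [h'] at h
  rw [h]
  have : (0 : ℝ) ≤ 2 / (M + 1) := by positivity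
  norm_num
  exact this

/-! ### Domination of the external field by the Dirichlet energy -/

/-- The embedding of `ℕ³` in the span of the first three coordinate directions. -/
def embed3 {d : ℕ} (v : Fin 3 → ℕ) : Site d := fun j => if h : j.1 < 3 then (v ⟨j.1, h⟩ : ℤ) else 0

/-- The coordinate vectors of the first three directions. -/
def unit3 {d : ℕ} (i : Fin 3) : Site d := embed3 (Pi.single i 1)

theorem embed3_add {d : ℕ} (v w : Fin 3 → ℕ) : (embed3 (v + w) : Site d) = embed3 v + embed3 w := by
  funext j
  simp only [embed3, Pi.add_apply]
  split_ifs <;> simp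

theorem embed3_apply_castLE {d : ℕ} (hd : 3 ≤ d) (v : Fin 3 → ℕ) (i : Fin 3) :
    (embed3 v : Site d) (Fin.castLE hd i) = v i := by
  simp [embed3]

theorem embed3_injective {d : ℕ} (hd : 3 ≤ d) :
    Function.Injective (embed3 : (Fin 3 → ℕ) → Site d) := by
  intro v w h
  funext i
  have := congrFun h (Fin.castLE hd i)
  simpa [embed3_apply_castLE hd] using this

theorem dist1_zero_unit3 {d : ℕ} (hd : 3 ≤ d) (i : Fin 3) : dist1 0 (unit3 i : Site d) = 1 := by
  have : (unit3 i : Site d) = Pi.single (Fin.castLE hd i) 1 := by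
    funext j
    simp only [unit3, embed3, Pi.single_apply, Fin.ext_iff, Fin.val_castLE]
    split_ifs <;> first | rfl | omega
  rw [this, dist1_zero_single]

/-- The sum of the first three coordinates lies in `[-B, B]` on `Λ` and rises by `M = 2B + 1`.
Truncating the flow at this level loses nothing for fields that vanish off `Λ`. -/
theorem exists_level_exit {d : ℕ} (hd : 3 ≤ d) (Λ : Finset (Site d)) :
    ∃ M : ℕ, ∀ x ∈ Λ, ∀ v ∈ level M, x + embed3 v ∉ Λ := by
  set f : Site d → ℤ := fun x => ∑ i : Fin 3, x (Fin.castLE hd i) with hf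
  set B := Λ.sup fun x => (f x).natAbs with hB
  refine ⟨2 * B + 1, fun x hx v hv hxv => ?_⟩
  have h1 : (f x).natAbs ≤ B := Finset.le_sup (f := fun x => (f x).natAbs) hx
  have h2 : (f (x + embed3 v)).natAbs ≤ B := Finset.le_sup (f := fun x => (f x).natAbs) hxv
  have h3 : f (x + embed3 v) = f x + (2 * B + 1 : ℕ) := by
    simp only [hf, Pi.add_apply, embed3_apply_castLE, Finset.sum_add_distrib]
    rw [← mem_level.1 hv]; push_cast; rfl
  omega

/-- The sites `z` for which the bond from `z` to `z + e_i` touches `Λ`. -/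
def touching {d : ℕ} (Λ : Finset (Site d)) (i : Fin 3) : Finset (Site d) :=
  Λ ∪ Λ.image fun x => x - unit3 i

theorem card_touching_le {d : ℕ} (Λ : Finset (Site d)) (i : Fin 3) :
    (touching Λ i).card ≤ 2 * Λ.card := by
  refine (Finset.card_union_le _ _).trans ?_
  have := Finset.card_image_le (s := Λ) (f := fun x => x - unit3 i)
  omega

/-- The current in the bond from `z` to `z + e_i` that is produced by the sources `ξ` in `Λ`. -/
noncomputable def current {d : ℕ} (Λ : Finset (Site d)) (M : ℕ) (ξ : Site d → ℝ) (i : Fin 3)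
    (z : Site d) : ℝ :=
  ∑ v ∈ simplex M, polyaFlow v i * (if z - embed3 v ∈ Λ then ξ (z - embed3 v) else 0)

/-- Summation by parts: each `φ x` is the pairing of its gradient with the flow started at `x`;
collecting the flows through a bond gives its current. -/
theorem sum_field_eq_sum_current {d : ℕ} {Λ : Finset (Site d)} {M : ℕ}
    (hM : ∀ x ∈ Λ, ∀ v ∈ level M, x + embed3 v ∉ Λ) (ξ : Site d → ℝ) {φ : Site d → ℝ}
    (hφ : ∀ x ∉ Λ, φ x = 0) :
    ∑ x ∈ Λ, ξ x * φ x =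
      ∑ i, ∑ z ∈ touching Λ i, (φ z - φ (z + unit3 i)) * current Λ M ξ i z := by
  have h1 : ∀ x ∈ Λ, ξ x * φ x = ∑ i, ∑ v ∈ simplex M,
      polyaFlow v i * (ξ x * (φ (x + embed3 v) - φ (x + embed3 v + unit3 i))) := by
    intro x hx
    have h := sum_polyaFlow_simplex M (fun v => φ (x + embed3 v)) fun v hv => hφ _ (hM x hx v hv)
    have h0 : (embed3 0 : Site d) = 0 := by funext j; simp [embed3]
    simp only [embed3_add, ← add_assoc, h0, add_zero] at h
    rw [← h, Finset.sum_comm, Finset.mul_sum]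
    refine Finset.sum_congr rfl fun v _ => ?_
    rw [Finset.mul_sum]
    exact Finset.sum_congr rfl fun i _ => by rw [unit3]; ring
  rw [Finset.sum_congr rfl h1, Finset.sum_comm]
  refine Finset.sum_congr rfl fun i _ => ?_
  simp only [current, Finset.mul_sum]
  rw [Finset.sum_comm, Finset.sum_comm (s := touching Λ i)]
  refine Finset.sum_congr rfl fun v _ => ?_
  -- Only nonzero terms need matching: bonds that do not touch `Λ` have zero gradient, and `current`
  -- has no sources off `Λ`.
  refine Finset.sum_bij_ne_zero (fun x _ _ => x + embed3 v) ?_ ?_ ?_ ?_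
  · intro x hx hne
    by_contra hcon
    simp only [touching, Finset.mem_union, Finset.mem_image, not_or, not_exists, not_and] at hcon
    refine hne ?_
    rw [hφ _ hcon.1, hφ (x + embed3 v + unit3 i) fun h => hcon.2 _ h (by simp)]
    simp
  · intro x _ _ y _ _ h
    exact add_right_cancel h
  · intro z hz hne
    have hzΛ : z - embed3 v ∈ Λ := by
      by_contra hcon
      simp [hcon] at hne
    refine ⟨z - embed3 v, hzΛ, ?_, sub_add_cancel _ _⟩
    simp only [hzΛ, if_true] at hne
    rw [sub_add_cancel]
    convert hne using 1
    ring
  · intro x hx _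
    simp only [add_sub_cancel_right, hx, if_true]
    ring

theorem neg_dirichlet_le_sum_field {d : ℕ} (hd : 3 ≤ d) {Λ : Finset (Site d)} {M : ℕ}
    (hM : ∀ x ∈ Λ, ∀ v ∈ level M, x + embed3 v ∉ Λ) (ξ : Site d → ℝ) {δ : ℝ} (hδ : 0 < δ)
    {φ : Site d → ℝ} (hφ : ∀ x ∉ Λ, φ x = 0) :
    -(δ * dirichlet Λ φ) - 3 / (8 * δ) * ∑ i, ∑ z ∈ touching Λ i, current Λ M ξ i z ^ 2 ≤
      (1 / 2) * ∑ x ∈ Λ, ξ x * φ x := by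
  rw [sum_field_eq_sum_current hM ξ hφ]
  have h1 : ∀ i, -(δ / 3 * dirichlet Λ φ)
      - 3 / (8 * δ) * ∑ z ∈ touching Λ i, current Λ M ξ i z ^ 2 ≤
      (1 / 2) * ∑ z ∈ touching Λ i, (φ z - φ (z + unit3 i)) * current Λ M ξ i z := by
    intro i
    have h2 := sum_sq_sub_le_two_mul_dirichlet hφ (dist1_zero_unit3 hd i) (touching Λ i)
    -- Young's inequality with `δ/3` per direction; the factor 2 of `h2` cancels the 1/2 in front of
    -- the field, and three directions add up to `δ`.
    have h3 : -(δ / 3 * ∑ z ∈ touching Λ i, (φ z - φ (z + unit3 i)) ^ 2)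
        - 3 / (4 * δ) * ∑ z ∈ touching Λ i, current Λ M ξ i z ^ 2 ≤
        ∑ z ∈ touching Λ i, (φ z - φ (z + unit3 i)) * current Λ M ξ i z := by
      rw [Finset.mul_sum, Finset.mul_sum, ← Finset.sum_neg_distrib, ← Finset.sum_sub_distrib]
      refine Finset.sum_le_sum fun z _ => ?_
      set g := φ z - φ (z + unit3 i)
      set J := current Λ M ξ i z
      have : δ / 3 * g ^ 2 + g * J + 3 / (4 * δ) * J ^ 2 = δ / 3 * (g + 3 / (2 * δ) * J) ^ 2 := by
        field_simp; ring
      have : 0 ≤ δ / 3 * (g + 3 / (2 * δ) * J) ^ 2 := by positivity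
      linarith
    have h4 := mul_le_mul_of_nonneg_left h2 (by positivity : 0 ≤ δ / 3)
    have h5 : 3 / (4 * δ) = 2 * (3 / (8 * δ)) := by field_simp; norm_num
    rw [h5] at h3
    linarith
  have h4 := Finset.sum_le_sum fun i (_ : i ∈ (Finset.univ : Finset (Fin 3))) => h1 i
  simp only [Finset.sum_sub_distrib, Finset.sum_const, ← Finset.mul_sum] at h4
  simp only [Finset.card_univ, Fintype.card_fin,
    nsmul_eq_mul] at h4
  push_cast at h4
  linarith

/-- Orthogonality removes the cross terms, so the second moment of a current is at most the variance
times the energy of the flow, independently of the box. -/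
theorem integral_sq_sum_le {Ω ι : Type*} [MeasurableSpace Ω] {P : Measure Ω} {s : Finset ι}
    {c : ι → ℝ} {X : ι → Ω → ℝ} {σ : ℝ} (hX : ∀ v ∈ s, MemLp (X v) 2 P)
    (horth : ∀ v ∈ s, ∀ w ∈ s, v ≠ w → ∫ ω, X v ω * X w ω ∂P = 0)
    (hσ : ∀ v ∈ s, ∫ ω, X v ω ^ 2 ∂P ≤ σ) :
    Integrable (fun ω => (∑ v ∈ s, c v * X v ω) ^ 2) P ∧
      ∫ ω, (∑ v ∈ s, c v * X v ω) ^ 2 ∂P ≤ σ * ∑ v ∈ s, c v ^ 2 := by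
  have hsum : MemLp (fun ω => ∑ v ∈ s, c v * X v ω) 2 P :=
    memLp_finsetSum _ fun v hv => (hX v hv).const_mul _
  refine ⟨hsum.integrable_sq, ?_⟩
  have hint : ∀ v ∈ s, ∀ w ∈ s, Integrable (fun ω => X v ω * X w ω) P := fun v hv w hw =>
    (hX v hv).integrable_mul (hX w hw)
  have h1 : ∀ ω, (∑ v ∈ s, c v * X v ω) ^ 2 =
      ∑ v ∈ s, ∑ w ∈ s, c v * c w * (X v ω * X w ω) := by
    intro ω
    rw [sq, Finset.sum_mul_sum]
    exact Finset.sum_congr rfl fun v _ => Finset.sum_congr rfl fun w _ => by ring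
  simp only [h1]
  rw [integral_finsetSum _ fun v hv => integrable_finsetSum _ fun w hw =>
    (hint v hv w hw).const_mul _, Finset.mul_sum]
  refine Finset.sum_le_sum fun v hv => ?_
  rw [integral_finsetSum _ fun w hw => (hint v hv w hw).const_mul _,
    Finset.sum_eq_single_of_mem v hv]
  · rw [integral_const_mul]
    have := hσ v hv
    simp only [sq] at this ⊢
    nlinarith [mul_self_nonneg (c v)]
  · intro w hw hwv
    rw [integral_const_mul, horth v hv w hw hwv.symm, mul_zero]

theorem integral_current_sq_le {d : ℕ} (hd : 3 ≤ d) {Ω : Type*} [MeasurableSpace Ω]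
    {P : Measure Ω} {ξ : Site d → Ω → ℝ} {σ : ℝ} (hξ2 : ∀ x, MemLp (ξ x) 2 P)
    (horth : ∀ x y, x ≠ y → ∫ ω, ξ x ω * ξ y ω ∂P = 0) (hσ : ∀ x, ∫ ω, ξ x ω ^ 2 ∂P ≤ σ)
    (Λ : Finset (Site d)) (M : ℕ) (i : Fin 3) (z : Site d) :
    Integrable (fun ω => current Λ M (fun x => ξ x ω) i z ^ 2) P ∧
      ∫ ω, current Λ M (fun x => ξ x ω) i z ^ 2 ∂P ≤
        σ * ∑ v ∈ simplex M, polyaFlow v i ^ 2 := by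
  have hσ0 : 0 ≤ σ := (integral_nonneg fun ω => sq_nonneg (ξ 0 ω)).trans (hσ 0)
  refine integral_sq_sum_le (X := fun v ω => if z - embed3 v ∈ Λ then ξ (z - embed3 v) ω else 0)
    (fun v _ => ?_) (fun v _ w _ hvw => ?_) (fun v _ => ?_)
  · split_ifs
    · exact hξ2 _
    · exact MemLp.zero'
  · have hne : z - embed3 v ≠ z - embed3 w := fun h =>
      hvw (embed3_injective hd (sub_right_injective h))
    by_cases h1 : z - embed3 v ∈ Λ <;> by_cases h2 : z - embed3 w ∈ Λ <;>
      simp [h1, h2, horth _ _ hne]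
  · split_ifs
    · exact hσ _
    · simpa using hσ0

/-- In dimension at least three, a centred uncorrelated external field is dominated by the Dirichlet
energy up to an error with a mean of the order of the volume. -/
theorem exists_field_bound {d : ℕ} (hd : 3 ≤ d) {Ω : Type*} [MeasurableSpace Ω]
    {P : Measure Ω} {ξ : Site d → Ω → ℝ} {σ : ℝ} (hξ2 : ∀ x, MemLp (ξ x) 2 P)
    (horth : ∀ x y, x ≠ y → ∫ ω, ξ x ω * ξ y ω ∂P = 0) (hσ : ∀ x, ∫ ω, ξ x ω ^ 2 ∂P ≤ σ)
    {δ : ℝ} (hδ : 0 < δ) (Λ : Finset (Site d)) :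
    ∃ Q : Ω → ℝ, (∀ ω, 0 ≤ Q ω) ∧ Integrable Q P ∧
      ∫ ω, Q ω ∂P ≤ Λ.card * (3 / (2 * δ) * σ) ∧
      ∀ ω, ∀ φ : Site d → ℝ, (∀ x ∉ Λ, φ x = 0) →
        -(δ * dirichlet Λ φ) - Q ω ≤ (1 / 2) * ∑ x ∈ Λ, ξ x ω * φ x := by
  obtain ⟨M, hM⟩ := exists_level_exit hd Λ
  have hσ0 : 0 ≤ σ := (integral_nonneg fun ω => sq_nonneg (ξ 0 ω)).trans (hσ 0)
  have hJ := integral_current_sq_le hd hξ2 horth hσ Λ M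
  refine ⟨fun ω => 3 / (8 * δ) *
    ∑ i, ∑ z ∈ touching Λ i, current Λ M (fun x => ξ x ω) i z ^ 2, fun ω => by positivity,
    (integrable_finsetSum _ fun i _ => integrable_finsetSum _ fun z _ => (hJ i z).1).const_mul _,
    ?_, fun ω φ hφ => neg_dirichlet_le_sum_field hd hM _ hδ hφ⟩
  rw [integral_const_mul, integral_finsetSum _ fun i _ => integrable_finsetSum _ fun z _ =>
    (hJ i z).1]
  have h1 : ∀ i, ∫ ω, ∑ z ∈ touching Λ i, current Λ M (fun x => ξ x ω) i z ^ 2 ∂P ≤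
      2 * Λ.card * (σ * ∑ v ∈ simplex M, polyaFlow v i ^ 2) := by
    intro i
    rw [integral_finsetSum _ fun z _ => (hJ i z).1]
    refine (Finset.sum_le_sum fun z _ => (hJ i z).2).trans ?_
    rw [Finset.sum_const, nsmul_eq_mul]
    have := card_touching_le Λ i
    gcongr
    exact_mod_cast this
  have h2 : ∑ i, ∫ ω, ∑ z ∈ touching Λ i, current Λ M (fun x => ξ x ω) i z ^ 2 ∂P ≤
      2 * Λ.card * (σ * 2) := by
    refine (Finset.sum_le_sum fun i _ => h1 i).trans ?_
    rw [← Finset.mul_sum, ← Finset.mul_sum, Finset.sum_comm]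
    have := sum_polyaFlow_sq_le M
    gcongr
  calc _ ≤ 3 / (8 * δ) * (2 * Λ.card * (σ * 2)) := by gcongr
    _ = _ := by field_simp; norm_num

/-! ### Measurable dependence on the environment -/

/-- The environments: the values of the bond potentials at rational points, and the external
field. -/
abbrev Env (d : ℕ) : Type := (Bond d → ℚ → ℝ) × (Site d → ℝ)

/-- The extension of a function on `ℚ` to `ℝ`; it recovers a continuous function from its values at
the rational points. -/
noncomputable def extendRat (w : ℚ → ℝ) (s : ℝ) : ℝ :=
  limsup (fun n : ℕ => w ((⌊s * (n + 1)⌋ : ℚ) / (n + 1))) atTop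

theorem extendRat_of_continuous {f : ℝ → ℝ} (hf : Continuous f) :
    extendRat (fun q => f q) = f := by
  funext s
  refine Tendsto.limsup_eq ?_
  have h : Tendsto (fun n : ℕ => ((⌊s * (n + 1)⌋ : ℝ) / (n + 1))) atTop (𝓝 s) := by
    have h1 : Tendsto (fun n : ℕ => s - 1 / ((n : ℝ) + 1)) atTop (𝓝 s) := by
      simpa using tendsto_const_nhds.sub (tendsto_one_div_add_atTop_nhds_zero_nat (𝕜 := ℝ))
    refine tendsto_of_tendsto_of_tendsto_of_le_of_le h1 tendsto_const_nhds (fun n => ?_)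
      fun n => ?_
    · have hn : (0 : ℝ) < n + 1 := by positivity
      have := Int.sub_one_lt_floor (s * (n + 1))
      simp only
      rw [le_div_iff₀ hn, sub_mul, one_div_mul_cancel hn.ne']
      exact this.le
    · have hn : (0 : ℝ) < n + 1 := by positivity
      simp only
      rw [div_le_iff₀ hn]
      exact Int.floor_le _
  have := (hf.tendsto s).comp h
  refine this.congr fun n => ?_
  simp

/-- Evaluation is jointly measurable on functions on the countable set `ℚ`, but not on all functions
`ℝ → ℝ` with the product σ-algebra; this is why an environment stores rational values only. -/
theorem measurable_extendRat : Measurable fun p : (ℚ → ℝ) × ℝ => extendRat p.1 p.2 := by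
  refine Measurable.limsup fun n => ?_
  have h1 : Measurable fun p : (ℚ → ℝ) × ℚ => p.1 p.2 :=
    measurable_from_prod_countable_left fun q => by fun_prop
  have h2 : Measurable fun s : ℝ => ((⌊s * (n + 1)⌋ : ℚ) / (n + 1)) :=
    (measurable_from_top (f := fun k : ℤ => (k : ℚ) / (n + 1))).comp
      (Int.measurable_floor.comp (by fun_prop))
  exact h1.comp (measurable_fst.prodMk (h2.comp measurable_snd))

/-- The Hamiltonian in a given environment. -/
noncomputable def envHamiltonian {d : ℕ} (e : Env d) :
    Finset (Site d) → (Site d → ℝ) → (Site d → ℝ) → ℝ :=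
  hamiltonian (fun b => extendRat (e.1 b)) e.2

theorem measurable_envHamiltonian {d : ℕ} (Λ : Finset (Site d)) (ψ : Site d → ℝ) :
    Measurable fun p : Env d × (Site d → ℝ) => envHamiltonian p.1 Λ ψ p.2 := by
  have hW : ∀ b, Measurable fun p : Env d × ℝ => extendRat (p.1.1 b) p.2 := fun b => by
    have h1 : Measurable fun w : Bond d → ℚ → ℝ => w b := measurable_pi_apply b
    have h2 : Measurable fun p : Env d × ℝ => p.1.1 := measurable_fst.comp measurable_fst
    have h : Measurable fun p : Env d × ℝ => (p.1.1 b, p.2) := (h1.comp h2).prodMk measurable_snd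
    exact (Measurable.comp (g := fun p : (ℚ → ℝ) × ℝ => extendRat p.1 p.2) measurable_extendRat h :)
  have hξ : ∀ x, Measurable fun e : Env d => e.2 x := fun x =>
    (measurable_pi_apply x).comp measurable_snd
  unfold envHamiltonian
  exact measurable_hamiltonian (W := fun e : Env d => fun b => extendRat (e.1 b))
    (ξ := fun e : Env d => e.2) hW hξ Λ ψ

theorem measurable_envHamiltonian_right {d : ℕ} (e : Env d) (Λ : Finset (Site d))
    (ψ : Site d → ℝ) : Measurable (envHamiltonian e Λ ψ) := by
  have h : Measurable fun φ : Site d → ℝ => envHamiltonian (e, φ).1 Λ ψ (e, φ).2 :=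
    (measurable_envHamiltonian Λ ψ).comp (measurable_prodMk_left (x := e))
  exact h

theorem measurable_lintegral_gibbs {d : ℕ} (Λ : Finset (Site d)) (ψ : Site d → ℝ)
    {F : (Site d → ℝ) → ℝ≥0∞} (hF : Measurable F) :
    Measurable fun e : Env d => ∫⁻ φ, F φ ∂(gibbs (envHamiltonian e Λ ψ) Λ ψ) := by
  simp only [lintegral_gibbs (measurable_envHamiltonian_right _ Λ ψ) Λ ψ hF]
  have hg := measurable_glue Λ (0 : Site d → ℝ)
  have hp : Measurable fun p : Env d × (Λ → ℝ) => (p.1, ψ + glue Λ 0 p.2) := by fun_prop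
  have hw : Measurable fun p : Env d × (Λ → ℝ) =>
      ENNReal.ofReal (Real.exp (-envHamiltonian p.1 Λ ψ (ψ + glue Λ 0 p.2))) :=
    ((measurable_envHamiltonian Λ ψ).comp hp).neg.exp.ennreal_ofReal
  refine Measurable.mul (Measurable.inv ?_) ?_
  · exact hw.lintegral_prod_right'
  · exact (hw.mul (hF.comp (measurable_snd.comp hp))).lintegral_prod_right'

theorem measurable_gradGibbs {d : ℕ} (Λ : Finset (Site d)) (ψ : Site d → ℝ) :
    Measurable fun e : Env d => gradGibbs (envHamiltonian e Λ ψ) Λ ψ := by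
  refine Measure.measurable_of_measurable_coe _ fun S hS => ?_
  have h : ∀ e : Env d, gradGibbs (envHamiltonian e Λ ψ) Λ ψ S =
      ∫⁻ φ, S.indicator 1 (grad φ) ∂(gibbs (envHamiltonian e Λ ψ) Λ ψ) := fun e => by
    rw [← lintegral_gradGibbs _ _ (measurable_one.indicator hS), lintegral_indicator_one hS]
  simp only [h]
  exact measurable_lintegral_gibbs Λ ψ
    ((measurable_one.indicator hS).comp continuous_grad.measurable)

/-! ### Translation covariance and invariance -/

/-- The translate of a bond. -/
def Bond.shift {d : ℕ} (b : Bond d) (v : Site d) : Bond d :=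
  ⟨(b.1.1 + v, b.1.2 + v), by rw [dist1_add_right]; exact b.2⟩

/-- The translate of an environment. -/
def Env.shift {d : ℕ} (v : Site d) (e : Env d) : Env d :=
  (fun b => e.1 (Bond.shift b v), fun x => e.2 (x + v))

theorem measurable_shift {d : ℕ} (v : Site d) : Measurable (Env.shift v) := by
  unfold Env.shift
  fun_prop

theorem add_mem_translate {d : ℕ} {Λ : Finset (Site d)} {v x : Site d} :
    x + v ∈ translate Λ v ↔ x ∈ Λ := by
  simp [translate]

theorem neighbors_add {d : ℕ} (x v : Site d) :
    neighbors (x + v) = (neighbors x).image (· + v) := by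
  ext y
  simp only [Finset.mem_image, mem_neighbors]
  constructor
  · intro h
    refine ⟨y - v, ?_, sub_add_cancel _ _⟩
    rw [← dist1_add_right _ _ v, sub_add_cancel]; exact h
  · rintro ⟨z, hz, rfl⟩
    rw [dist1_add_right]; exact hz

/-- Bond terms see only tilt differences, which are translation invariant; the field term leaves a
constant independent of `f`, which drops out after normalization. -/
theorem hamiltonian_translate {d : ℕ} (W : Bond d → ℝ → ℝ) (ξ : Site d → ℝ) (Λ : Finset (Site d))
    (v : Site d) (u : Fin d → ℝ) {f : Site d → ℝ} (hf : ∀ x ∉ Λ, f (x + v) = 0) :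
    hamiltonian W ξ (translate Λ v) (tilt u) (tilt u + f) =
      hamiltonian (fun b => W (Bond.shift b v)) (fun x => ξ (x + v)) Λ (tilt u)
        (tilt u + fun x => f (x + v)) + (1 / 2) * ∑ x ∈ Λ, ξ (x + v) * tilt u v := by
  unfold hamiltonian
  have hf' : ∀ x ∉ translate Λ v, f x = 0 := fun x hx => by
    rw [← sub_add_cancel x v]
    refine hf _ fun h => hx ?_
    rw [← sub_add_cancel x v]; exact add_mem_translate.2 h
  rw [hamiltonianB_eq_sum _ _ fun x hx => by simp [hf' x hx],
    hamiltonianB_eq_sum _ _ fun x hx => by simp [hf x hx], add_assoc, ← mul_add,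
    ← Finset.sum_add_distrib]
  congr 1
  · rw [translate, Finset.sum_image fun _ _ _ _ h => add_right_cancel h]
    refine Finset.sum_congr rfl fun x _ => ?_
    rw [neighbors_add, Finset.sum_image fun _ _ _ _ h => add_right_cancel h]
    refine Finset.sum_congr rfl fun y hy => ?_
    have h := mem_neighbors.1 hy
    have h' : dist1 (x + v) (y + v) = 1 := by rw [dist1_add_right]; exact h
    rw [pairPotential_of_eq _ h', pairPotential_of_eq _ h]
    congr 1
    · simp only [bondWeight, Finset.mem_image, add_left_inj, exists_eq_right]
    · simp only [Bond.shift, Pi.add_apply, tilt_add]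
      congr 1; ring
  · congr 1
    rw [translate, Finset.sum_image fun _ _ _ _ h => add_right_cancel h]
    refine Finset.sum_congr rfl fun x _ => ?_
    simp only [Pi.add_apply, tilt_add]
    ring

/-- The bijection `x ↦ x + v` from `Λ` to its translate. -/
noncomputable def translateEquiv {d : ℕ} (Λ : Finset (Site d)) (v : Site d) :
    Λ ≃ translate Λ v :=
  Equiv.subtypeEquiv (Equiv.addRight v) fun _ => add_mem_translate.symm

/-- Translation covariance of the finite-volume Gibbs measures. -/
theorem lintegral_gibbs_translate {d : ℕ} (e : Env d) (Λ : Finset (Site d)) (v : Site d)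
    (u : Fin d → ℝ) {G : (Site d → ℝ) → ℝ≥0∞} (hG : Measurable G) :
    ∫⁻ φ, G (fun x => φ (x + v) - tilt u (x + v))
        ∂(gibbs (envHamiltonian e (translate Λ v) (tilt u)) (translate Λ v) (tilt u)) =
      ∫⁻ φ, G (φ - tilt u)
        ∂(gibbs (envHamiltonian (e.shift v) Λ (tilt u)) Λ (tilt u)) := by
  have hH := fun e Λ => measurable_envHamiltonian_right (d := d) e Λ (tilt u)
  have hG1 : Measurable fun φ : Site d → ℝ => G (fun x => φ (x + v) - tilt u (x + v)) :=
    hG.comp (by fun_prop)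
  have hG2 : Measurable fun φ : Site d → ℝ => G (φ - tilt u) := hG.comp (by fun_prop)
  rw [lintegral_gibbs (hH _ _) _ _ hG1, lintegral_gibbs (hH _ _) _ _ hG2]
  have hmp := volume_measurePreserving_piCongrLeft (fun _ => ℝ) (translateEquiv Λ v)
  set c : ℝ := (1 / 2) * ∑ x ∈ Λ, e.2 (x + v) * tilt u v with hc
  have hglue : ∀ φ : Λ → ℝ, ∀ x,
      glue (translate Λ v) 0
        (MeasurableEquiv.piCongrLeft (fun _ => ℝ) (translateEquiv Λ v) φ) (x + v) =
        glue Λ 0 φ x := by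
    intro φ x
    by_cases hx : x ∈ Λ
    · rw [glue_of_mem hx, glue_of_mem (add_mem_translate.2 hx)]
      exact Equiv.piCongrLeft_apply_apply (fun _ => ℝ) (translateEquiv Λ v) φ ⟨x, hx⟩
    · rw [glue_of_notMem hx, glue_of_notMem (fun h => hx (add_mem_translate.1 h))]
      rfl
  have hham : ∀ φ : Λ → ℝ, ENNReal.ofReal (Real.exp (-envHamiltonian e (translate Λ v) (tilt u)
      (tilt u + glue (translate Λ v) 0
        (MeasurableEquiv.piCongrLeft (fun _ => ℝ) (translateEquiv Λ v) φ)))) =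
      ENNReal.ofReal (Real.exp (-c)) * ENNReal.ofReal
        (Real.exp (-envHamiltonian (e.shift v) Λ (tilt u) (tilt u + glue Λ 0 φ))) := by
    intro φ
    rw [← ENNReal.ofReal_mul (by positivity), ← Real.exp_add, envHamiltonian,
      hamiltonian_translate _ _ _ _ _ fun x hx => by rw [hglue, glue_of_notMem hx]; rfl]
    simp only [hglue, ← hc]
    congr 2
    rw [neg_add_rev]
    rfl
  have hc0 : ENNReal.ofReal (Real.exp (-c)) ≠ 0 := by simp [Real.exp_pos]
  have hGm : Measurable fun φ : Λ → ℝ => G (glue Λ 0 φ) := hG.comp (measurable_glue Λ 0)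
  have hw : Measurable fun φ : Λ → ℝ => ENNReal.ofReal
      (Real.exp (-envHamiltonian (e.shift v) Λ (tilt u) (tilt u + glue Λ 0 φ))) := by
    have := hH (e.shift v) Λ
    have := measurable_glue Λ (0 : Site d → ℝ)
    fun_prop
  have hm : Measurable fun φ : Λ → ℝ => ENNReal.ofReal
      (Real.exp (-envHamiltonian (e.shift v) Λ (tilt u) (tilt u + glue Λ 0 φ))) *
        G (glue Λ 0 φ) := hw.mul hGm
  have hsub : ∀ (φ : Λ → ℝ) (x : Site d), (tilt u + glue (translate Λ v) 0
        (MeasurableEquiv.piCongrLeft (fun _ => ℝ) (translateEquiv Λ v) φ)) (x + v) -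
          tilt u (x + v) = glue Λ 0 φ x := by
    intro φ x
    rw [Pi.add_apply, hglue, add_sub_cancel_left]
  rw [← hmp.lintegral_comp_emb (MeasurableEquiv.measurableEmbedding _),
    ← hmp.lintegral_comp_emb (MeasurableEquiv.measurableEmbedding _)]
  have hglue_eta : ∀ φ : Λ → ℝ, (fun x => glue Λ 0 φ x) = glue Λ 0 φ := fun _ => rfl
  simp only [hham, hsub, hglue_eta, add_sub_cancel_left]
  simp only [mul_assoc]
  rw [lintegral_const_mul _ hw, lintegral_const_mul _ hm,
    ENNReal.mul_inv (Or.inl hc0) (Or.inl ENNReal.ofReal_ne_top)]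
  rw [mul_mul_mul_comm, ENNReal.inv_mul_cancel hc0 ENNReal.ofReal_ne_top, one_mul]

/-- The law of an i.i.d. family is invariant under injective relabellings. -/
theorem map_relabel_eq_map {ι Ω E : Type*} [Countable ι] [MeasurableSpace Ω] [MeasurableSpace E]
    {P : Measure Ω} [IsProbabilityMeasure P] {X : ι → Ω → E} (hX : ∀ i, Measurable (X i))
    (hind : iIndepFun X P) (hid : ∀ i j, IdentDistrib (X i) (X j) P P) {σ : ι → ι}
    (hσ : Function.Injective σ) :
    P.map (fun ω i => X (σ i) ω) = P.map (fun ω i => X i ω) := by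
  rw [(hind.precomp hσ).map_fun_eq_infinitePi_map₀' fun i => (hX _).aemeasurable,
    hind.map_fun_eq_infinitePi_map₀' fun i => (hX _).aemeasurable]
  congr 1
  funext i
  exact (hid _ _).map_eq

/-! ### Tightness and weak limits from second moments -/

theorem isClosed_plaquetteCondition (d : ℕ) :
    IsClosed {η : Bond d → ℝ | PlaquetteCondition η} := by
  simp only [PlaquetteCondition, Set.ofPred_and, Set.ofPred_forall]
  refine IsClosed.inter (isClosed_iInter fun b => isClosed_eq (by fun_prop) (by fun_prop)) ?_
  refine isClosed_iInter fun b₁ => isClosed_iInter fun b₂ => isClosed_iInter fun b₃ =>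
    isClosed_iInter fun b₄ => isClosed_iInter fun _ => isClosed_iInter fun _ =>
    isClosed_iInter fun _ => isClosed_iInter fun _ => isClosed_iInter fun _ =>
    isClosed_eq (by fun_prop) (by fun_prop)

theorem isCompact_bounded_gradField {d : ℕ} (M : Bond d → ℝ) :
    IsCompact {η : GradField d | ∀ b, |η.1 b| ≤ M b} := by
  have h1 : IsCompact (Set.univ.pi fun b : Bond d => Set.Icc (-M b) (M b)) :=
    isCompact_univ_pi fun b => isCompact_Icc
  have h2 := (isClosed_plaquetteCondition d).isClosedEmbedding_subtypeVal.isCompact_preimage h1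
  have h3 : {η : GradField d | ∀ b, |η.1 b| ≤ M b} =
      Subtype.val ⁻¹' (Set.univ.pi fun b : Bond d => Set.Icc (-M b) (M b)) := by
    ext η
    simp only [Set.mem_preimage, Set.mem_univ_pi, Set.mem_Icc, abs_le, Set.mem_ofPred_eq]
  rw [h3]
  exact h2

theorem measurable_bond {d : ℕ} (b : Bond d) : Measurable fun η : GradField d => η.1 b :=
  (measurable_pi_apply b).comp measurable_subtype_coe

/-- Gradient measures whose bond variables have bounded second moments are tight. -/
theorem isTightMeasureSet_of_sq_le {d : ℕ} {S : Set (Measure (GradField d))} {K : Bond d → ℝ}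
    (hK : ∀ μ ∈ S, ∀ b, ∫⁻ η, ENNReal.ofReal (η.1 b ^ 2) ∂μ ≤ ENNReal.ofReal (K b)) :
    IsTightMeasureSet S := by
  rw [isTightMeasureSet_iff_exists_isCompact_measure_compl_le]
  intro ε hε
  -- The bonds are countable: distribute `ε` over them and cut off each at `√(n b)`, where Markov's
  -- inequality leaves at most `ε' b`.
  obtain ⟨ε', hε', hsum⟩ := ENNReal.exists_pos_sum_of_countable' hε.ne' (Bond d)
  choose n hn using fun b => ENNReal.exists_nat_mul_gt (hε' b).ne'
    (ENNReal.ofReal_ne_top (r := K b))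
  refine ⟨_, isCompact_bounded_gradField fun b => √(n b), fun μ hμ => ?_⟩
  have hsub : {η : GradField d | ∀ b, |η.1 b| ≤ √(n b)}ᶜ ⊆
      ⋃ b, {η : GradField d | (n b : ℝ≥0∞) ≤ ENNReal.ofReal (η.1 b ^ 2)} := by
    intro η hη
    simp only [Set.mem_compl_iff, Set.mem_ofPred_eq, not_forall, not_le] at hη
    obtain ⟨b, hb⟩ := hη
    refine Set.mem_iUnion.2 ⟨b, ?_⟩
    simp only [Set.mem_ofPred_eq]
    rw [← ENNReal.ofReal_natCast, ← sq_abs]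
    refine ENNReal.ofReal_le_ofReal ?_
    exact ((Real.sqrt_lt' (lt_of_le_of_lt (Real.sqrt_nonneg _) hb)).1 hb).le
  refine (measure_mono hsub).trans ((measure_iUnion_le _).trans (le_trans ?_ hsum.le))
  refine ENNReal.tsum_le_tsum fun b => ?_
  have hm : Measurable fun η : GradField d => ENNReal.ofReal (η.1 b ^ 2) :=
    ((measurable_bond b).pow_const 2).ennreal_ofReal
  have h1 := (mul_meas_ge_le_lintegral (μ := μ) hm (n b)).trans ((hK μ hμ b).trans (hn b).le)
  have h0 : (n b : ℝ≥0∞) ≠ 0 := fun h => by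
    have := hn b
    simp [h] at this
  exact (ENNReal.mul_le_mul_iff_right h0 (ENNReal.natCast_ne_top _)).1 h1

theorem tightWithLimits_of_sq_le {d : ℕ} {μ : ℕ → Measure (GradField d)}
    (hμ : ∀ N, IsProbabilityMeasure (μ N)) {K : Bond d → ℝ}
    (hK : ∀ N b, ∫⁻ η, ENNReal.ofReal (η.1 b ^ 2) ∂(μ N) ≤ ENNReal.ofReal (K b)) :
    TightWithLimits μ := by
  have htight : IsTightMeasureSet (Set.range μ) :=
    isTightMeasureSet_of_sq_le (K := K) (by rintro _ ⟨N, rfl⟩; exact hK N)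
  refine ⟨htight, fun N => ⟨μ N, hμ N⟩, fun N => rfl, fun s hs => ?_⟩
  have hemb : IsEmbedding (Subtype.val : GradField d → Bond d → ℝ) := .subtypeVal
  have : SecondCountableTopology (GradField d) := hemb.secondCountableTopology
  have : TopologicalSpace.PseudoMetrizableSpace (GradField d) :=
    hemb.isInducing.pseudoMetrizableSpace
  set p : ℕ → ProbabilityMeasure (GradField d) := fun N => ⟨μ N, hμ N⟩ with hp
  have hcomp : IsCompact (closure (Set.range p)) :=
    isCompact_closure_of_isTightMeasureSet (htight.subset (by
      rintro _ ⟨_, ⟨N, rfl⟩, rfl⟩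
      exact ⟨N, rfl⟩))
  obtain ⟨q, _, t, ht, hq⟩ := hcomp.isSeqCompact
    (x := fun k => p (s k)) fun k => subset_closure ⟨s k, rfl⟩
  exact ⟨t, q, ht, hq⟩

/-! ### Uniform moment bounds for regular disorder -/

/-- The assumptions on the disorder that the energy estimate uses: a translation invariant law,
quadratic bounds on the bond potentials with integrable errors, and an external field that is
dominated by the Dirichlet energy up to an error of the order of the volume. -/
structure RegularDisorder {d : ℕ} {Ω : Type*} [MeasurableSpace Ω] (P : Measure Ω)
    (E : Ω → Env d) (A C m κ : ℝ) : Prop where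
  measurable : Measurable E
  shift_law : ∀ v, P.map (fun ω => (E ω).shift v) = P.map E
  potential_bound : ∃ β : Bond d → Ω → ℝ, (∀ b ω, 0 ≤ β b ω) ∧ (∀ b, Integrable (β b) P) ∧
    (∀ b, ∫ ω, β b ω ∂P ≤ m) ∧ ∀ᵐ ω ∂P, ∀ b s, A * s ^ 2 - β b ω ≤ extendRat ((E ω).1 b) s ∧
      extendRat ((E ω).1 b) s ≤ C * s ^ 2 + β b ω
  field_bound : ∀ Λ : Finset (Site d), ∃ Q : Ω → ℝ, (∀ ω, 0 ≤ Q ω) ∧ Integrable Q P ∧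
    ∫ ω, Q ω ∂P ≤ Λ.card * κ ∧ ∀ ω, ∀ φ : Site d → ℝ, (∀ x ∉ Λ, φ x = 0) →
      -(A / 8 * dirichlet Λ φ) - Q ω ≤ (1 / 2) * ∑ x ∈ Λ, (E ω).2 x * φ x

theorem energyConst_nonneg {d : ℕ} (u : Fin d → ℝ) {A C : ℝ} (hA : 0 < A) (hC : 0 < C) :
    0 ≤ energyConst d u A C := by
  unfold energyConst
  positivity

theorem integral_bondSum_le {d : ℕ} {Ω : Type*} [MeasurableSpace Ω] {P : Measure Ω}
    {β : Bond d → Ω → ℝ} {m : ℝ} (hm : 0 ≤ m) (hβ : ∀ b, Integrable (β b) P)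
    (hβm : ∀ b, ∫ ω, β b ω ∂P ≤ m) (Λ : Finset (Site d)) :
    Integrable (fun ω => bondSum Λ fun b => β b ω) P ∧
      ∫ ω, bondSum Λ (fun b => β b ω) ∂P ≤ Λ.card * (3 ^ d * m) := by
  have h1 : ∀ x, ∀ y ∈ neighbors x,
      Integrable (fun ω => pairPotential (fun b _ => β b ω) x y 0) P ∧
        ∫ ω, pairPotential (fun b _ => β b ω) x y 0 ∂P ≤ m := by
    intro x y hy
    simp only [pairPotential_of_eq _ (mem_neighbors.1 hy)]
    exact ⟨hβ _, hβm _⟩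
  unfold bondSum
  refine ⟨integrable_finsetSum _ fun x _ => integrable_finsetSum _ fun y hy => (h1 x y hy).1, ?_⟩
  rw [integral_finsetSum _ fun x _ => integrable_finsetSum _ fun y hy => (h1 x y hy).1]
  refine (Finset.sum_le_sum (g := fun _ => 3 ^ d * m) fun x _ => ?_).trans (by simp)
  rw [integral_finsetSum _ fun y hy => (h1 x y hy).1]
  refine (Finset.sum_le_sum fun y hy => (h1 x y hy).2).trans ?_
  rw [Finset.sum_const, nsmul_eq_mul]
  have := card_neighbors_le x
  gcongr
  exact_mod_cast this

theorem RegularDisorder.mean_nonneg {d : ℕ} {Ω : Type*} [MeasurableSpace Ω] {P : Measure Ω}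
    {E : Ω → Env d} {A C m κ : ℝ} (hE : RegularDisorder P E A C m κ) (hd : 1 ≤ d) : 0 ≤ m := by
  obtain ⟨β, h0, _, h2, _⟩ := hE.potential_bound
  let b : Bond d := ⟨(0, Pi.single ⟨0, hd⟩ 1), dist1_zero_single _⟩
  exact (integral_nonneg (h0 b)).trans (h2 b)

theorem measurable_spatialAverage {d : ℕ} (u : Fin d → ℝ) (Λ : Finset (Site d)) :
    Measurable fun e : Env d => spatialAverage (envHamiltonian e) u Λ := by
  refine Measure.measurable_of_measurable_coe _ fun S hS => ?_
  have h : ∀ e : Env d, spatialAverage (envHamiltonian e) u Λ S = (Λ.card : ℝ≥0∞)⁻¹ *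
      ∑ x ∈ Λ, gradGibbs (envHamiltonian e (translate Λ x) (tilt u)) (translate Λ x) (tilt u) S :=
    fun e => by simp [spatialAverage, Measure.finsetSum_apply]
  simp only [h]
  refine Measurable.const_mul (Finset.measurable_sum _ fun x _ => ?_) _
  exact (Measure.measurable_coe hS).comp (measurable_gradGibbs _ _)

theorem lintegral_averagedMeasure {d : ℕ} {Ω : Type*} [MeasurableSpace Ω] {P : Measure Ω}
    {E : Ω → Env d} (hE : Measurable E) (u : Fin d → ℝ) (Λ : Finset (Site d))
    {f : GradField d → ℝ≥0∞} (hf : Measurable f) :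
    ∫⁻ η, f η ∂(averagedMeasure P (fun ω => envHamiltonian (E ω)) u Λ) =
      (Λ.card : ℝ≥0∞)⁻¹ * ∑ x ∈ Λ, ∫⁻ ω, ∫⁻ φ, f (grad φ)
        ∂(gibbs (envHamiltonian (E ω) (translate Λ x) (tilt u)) (translate Λ x) (tilt u)) ∂P := by
  have hm : Measurable fun ω => spatialAverage (envHamiltonian (E ω)) u Λ :=
    (measurable_spatialAverage u Λ).comp hE
  have hG : ∀ x, Measurable fun ω => ∫⁻ φ, f (grad φ)
        ∂(gibbs (envHamiltonian (E ω) (translate Λ x) (tilt u)) (translate Λ x) (tilt u)) :=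
    fun x => (measurable_lintegral_gibbs _ _ (hf.comp continuous_grad.measurable)).comp hE
  unfold averagedMeasure
  rw [Measure.lintegral_bind (hm.aemeasurable) hf.aemeasurable,
    ← lintegral_finsetSum _ fun x _ => hG x, ← lintegral_const_mul _
      (Finset.measurable_sum _ fun x _ => hG x)]
  refine lintegral_congr fun ω => ?_
  rw [spatialAverage, lintegral_smul_measure, lintegral_finsetSum_measure, smul_eq_mul]
  simp only [lintegral_gradGibbs _ _ hf]

theorem lintegral_gibbs_mono {d : ℕ} {H : (Site d → ℝ) → ℝ} (hH : Measurable H) (Λ : Finset (Site d))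
    (ψ : Site d → ℝ) {F F' : (Site d → ℝ) → ℝ≥0∞} (hF : Measurable F) (hF' : Measurable F')
    (h : ∀ f : Site d → ℝ, (∀ x ∉ Λ, f x = 0) → F (ψ + f) ≤ F' (ψ + f)) :
    ∫⁻ φ, F φ ∂(gibbs H Λ ψ) ≤ ∫⁻ φ, F' φ ∂(gibbs H Λ ψ) := by
  rw [lintegral_gibbs hH _ _ hF, lintegral_gibbs hH _ _ hF']
  gcongr with φ
  exact h _ fun x hx => glue_of_notMem hx

section

variable {d : ℕ} {Ω : Type*} [MeasurableSpace Ω] {P : Measure Ω} [IsProbabilityMeasure P]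
  {E : Ω → Env d} {A C m κ : ℝ}

/-- Almost surely the partition function is finite and nonzero, and the mean Dirichlet energy is of
the order of the volume. -/
theorem RegularDisorder.ae_partition_and_energy_le (hE : RegularDisorder P E A C m κ) (hd : 1 ≤ d) (hA : 0 < A)
    (hC : 0 < C) (u : Fin d → ℝ) (Λ : Finset (Site d)) :
    (∀ᵐ ω ∂P, unnormalizedGibbs (envHamiltonian (E ω) Λ (tilt u)) Λ (tilt u) Set.univ ≠ 0 ∧
      unnormalizedGibbs (envHamiltonian (E ω) Λ (tilt u)) Λ (tilt u) Set.univ ≠ ⊤) ∧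
    ∫⁻ ω, ∫⁻ φ, ENNReal.ofReal (A / 16 * dirichlet Λ (φ - tilt u))
        ∂(gibbs (envHamiltonian (E ω) Λ (tilt u)) Λ (tilt u)) ∂P ≤
      ENNReal.ofReal (Λ.card * (energyConst d u A C + 2 * (3 ^ d * m) + κ)) + 1 := by
  obtain ⟨β, hβ0, hβi, hβm, hβ⟩ := hE.potential_bound
  obtain ⟨Q, hQ0, hQi, hQm, hQ⟩ := hE.field_bound Λ
  have hmeas : ∀ ω b, Measurable (extendRat ((E ω).1 b)) := fun ω b =>
    (measurable_extendRat.comp (measurable_prodMk_left (x := (E ω).1 b)) :)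
  have key := hβ.mono fun ω h =>
    gibbs_dirichlet_le hd u hA hC (fun b => hβ0 b ω) (hmeas ω) h Λ (hQ ω)
  simp only [envHamiltonian]
  refine ⟨key.mono fun ω h => ⟨h.1, h.2.1⟩, ?_⟩
  refine (lintegral_mono_ae (key.mono fun ω h => h.2.2)).trans ?_
  rw [lintegral_add_right _ measurable_const, lintegral_const, measure_univ, mul_one]
  gcongr
  obtain ⟨hSi, hSm⟩ := integral_bondSum_le (hE.mean_nonneg hd) hβi hβm Λ
  have hc := energyConst_nonneg u hA hC
  have hint : Integrable (fun ω => Λ.card * energyConst d u A C +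
      2 * bondSum Λ (fun b => β b ω) + Q ω) P :=
    ((integrable_const _).add (hSi.const_mul 2)).add hQi
  rw [← ofReal_integral_eq_lintegral_ofReal hint (Eventually.of_forall fun ω => by
    have h1 := bondSum_nonneg Λ fun b => hβ0 b ω
    have h2 := hQ0 ω
    simp only [Pi.zero_apply]
    positivity)]
  refine ENNReal.ofReal_le_ofReal ?_
  have hint' : Integrable (fun ω => Λ.card * energyConst d u A C +
      2 * bondSum Λ (fun b => β b ω)) P := (integrable_const _).add (hSi.const_mul 2)
  rw [integral_add hint' hQi, integral_add (integrable_const _) (hSi.const_mul 2),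
    integral_const, integral_const_mul]
  simp only [probReal_univ, one_smul]
  linarith

theorem RegularDisorder.isProbabilityMeasure_averagedMeasure (hE : RegularDisorder P E A C m κ)
    (hd : 1 ≤ d) (hA : 0 < A) (hC : 0 < C) (u : Fin d → ℝ) {Λ : Finset (Site d)}
    (hΛ : Λ.Nonempty) :
    IsProbabilityMeasure (averagedMeasure P (fun ω => envHamiltonian (E ω)) u Λ) := by
  refine ⟨?_⟩
  rw [← lintegral_one, lintegral_averagedMeasure hE.measurable u Λ measurable_const]
  have h1 : ∀ x ∈ Λ, ∫⁻ ω, ∫⁻ _φ : Site d → ℝ, (1 : ℝ≥0∞)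
      ∂(gibbs (envHamiltonian (E ω) (translate Λ x) (tilt u)) (translate Λ x) (tilt u)) ∂P = 1 := by
    intro x _
    have h := (hE.ae_partition_and_energy_le hd hA hC u (translate Λ x)).1
    rw [lintegral_congr_ae (g := fun _ => 1) (h.mono fun ω h => ?_)]
    · simp
    · simp only [lintegral_one]
      rw [gibbs, Measure.smul_apply, smul_eq_mul, ENNReal.inv_mul_cancel h.1 h.2]
  rw [Finset.sum_congr rfl h1, Finset.sum_const, nsmul_eq_mul, mul_one,
    ENNReal.inv_mul_cancel (by simpa using hΛ.ne_empty) (ENNReal.natCast_ne_top _)]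

/-- The averaged measures have uniformly bounded second moments of the centred bond variables. -/
theorem RegularDisorder.lintegral_sq_le (hE : RegularDisorder P E A C m κ)
    (hd : 1 ≤ d) (hA : 0 < A) (hC : 0 < C) (hκ : 0 ≤ κ) (u : Fin d → ℝ) {Λ : Finset (Site d)}
    (hΛ : Λ.Nonempty) (x₀ y₀ : Site d) (h : dist1 y₀ x₀ = 1) :
    ∫⁻ η, ENNReal.ofReal ((η.1 ⟨(y₀, x₀), h⟩ - tilt u (x₀ - y₀)) ^ 2)
        ∂(averagedMeasure P (fun ω => envHamiltonian (E ω)) u Λ) ≤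
      ENNReal.ofReal (32 / A * (energyConst d u A C + 2 * (3 ^ d * m) + κ + 1)) := by
  have hHm : ∀ e Λ, Measurable (envHamiltonian e Λ (tilt u)) := fun e Λ =>
    measurable_envHamiltonian_right e Λ (tilt u)
  have hdm := measurable_dirichlet Λ
  rw [lintegral_averagedMeasure hE.measurable u Λ
    (((measurable_bond _).sub_const _).pow_const 2).ennreal_ofReal]
  set G : Site d → (Site d → ℝ) → ℝ≥0∞ := fun x g =>
    ENNReal.ofReal ((g (x₀ - x) - g (y₀ - x)) ^ 2) with hG
  have hGm : ∀ x, Measurable (G x) := fun x => by fun_prop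
  have hGm' : ∀ x, Measurable fun φ => G x (φ - tilt u) := fun x => by fun_prop
  set Ψ : Site d → Env d → ℝ≥0∞ := fun x e =>
    ∫⁻ φ, G x (φ - tilt u) ∂(gibbs (envHamiltonian e Λ (tilt u)) Λ (tilt u)) with hΨ
  have hΨm : ∀ x, Measurable (Ψ x) := fun x => measurable_lintegral_gibbs _ _ (hGm' x)
  have hΨE : ∀ x, Measurable fun ω => Ψ x (E ω) := fun x => (hΨm x).comp hE.measurable
  -- Move the translation from the box to the environment, where the invariant law absorbs it; the
  -- bond moves by `-x` and the box is now the same for all `x`.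
  have hshift : ∀ x ∈ Λ, ∫⁻ ω, ∫⁻ φ, ENNReal.ofReal
        (((grad φ).1 ⟨(y₀, x₀), h⟩ - tilt u (x₀ - y₀)) ^ 2)
        ∂(gibbs (envHamiltonian (E ω) (translate Λ x) (tilt u)) (translate Λ x) (tilt u)) ∂P =
      ∫⁻ ω, Ψ x (E ω) ∂P := by
    intro x _
    have hsm : Measurable fun ω => (E ω).shift x := (measurable_shift x).comp hE.measurable
    rw [← lintegral_map (hΨm x) hE.measurable, ← hE.shift_law x,
      lintegral_map (hΨm x) hsm]
    refine lintegral_congr fun ω => ?_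
    simp only [hΨ]
    rw [← lintegral_gibbs_translate (E ω) Λ x u (hGm x)]
    refine lintegral_congr fun φ => ?_
    simp only [hG, grad, sub_add_cancel, tilt_sub]
    congr 2; ring
  rw [Finset.sum_congr rfl hshift, ← lintegral_finsetSum _ fun x _ => hΨE x]
  have hsum : ∀ ω, ∑ x ∈ Λ, Ψ x (E ω) ≤ ENNReal.ofReal (32 / A) *
      ∫⁻ φ, ENNReal.ofReal (A / 16 * dirichlet Λ (φ - tilt u))
        ∂(gibbs (envHamiltonian (E ω) Λ (tilt u)) Λ (tilt u)) := by
    intro ω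
    simp only [hΨ]
    rw [← lintegral_finsetSum _ fun x _ => hGm' x, ← lintegral_const_mul _ (by fun_prop)]
    refine lintegral_gibbs_mono (hHm _ _) Λ _ (Finset.measurable_sum _ fun x _ => hGm' x)
      (by fun_prop) fun f hf => ?_
    simp only [hG, add_sub_cancel_left]
    rw [← ENNReal.ofReal_mul (by positivity),
      ← ENNReal.ofReal_sum_of_nonneg fun x _ => sq_nonneg _]
    refine ENNReal.ofReal_le_ofReal ?_
    have he : dist1 0 (y₀ - x₀) = 1 := by
      rw [← dist1_self_add x₀, add_sub_cancel, dist1_comm, h]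
    have hb := sum_sq_sub_le_two_mul_dirichlet hf he (Λ.image fun x => x₀ - x)
    rw [Finset.sum_image fun _ _ _ _ h => sub_right_injective h] at hb
    have e1 : 32 / A * (A / 16 * dirichlet Λ f) = 2 * dirichlet Λ f := by
      field_simp
      ring
    rw [e1]
    refine le_trans (le_of_eq (Finset.sum_congr rfl fun x _ => ?_)) hb
    have e2 : x₀ - x + (y₀ - x₀) = y₀ - x := by abel
    simp only [e2]
  have hm0 := hE.mean_nonneg hd
  have hc := energyConst_nonneg u hA hC
  set k := energyConst d u A C + 2 * (3 ^ d * m) + κ with hk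
  have hk0 : 0 ≤ k := by positivity
  have hn : (1 : ℝ) ≤ Λ.card := by exact_mod_cast hΛ.card_pos
  calc (Λ.card : ℝ≥0∞)⁻¹ * ∫⁻ ω, ∑ x ∈ Λ, Ψ x (E ω) ∂P
      ≤ (Λ.card : ℝ≥0∞)⁻¹ * (ENNReal.ofReal (32 / A) * (ENNReal.ofReal (Λ.card * k) + 1)) := by
        gcongr
        refine (lintegral_mono hsum).trans ?_
        rw [lintegral_const_mul' _ _ ENNReal.ofReal_ne_top]
        gcongr
        exact (hE.ae_partition_and_energy_le hd hA hC u Λ).2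
    -- The extra 1 of the energy estimate is absorbed because `Λ` has at least one site.
    _ ≤ (Λ.card : ℝ≥0∞)⁻¹ * (Λ.card * ENNReal.ofReal (32 / A * (k + 1))) := by
        refine mul_le_mul_right ?_ _
        rw [← ENNReal.ofReal_one, ← ENNReal.ofReal_add (by positivity) zero_le_one,
          ← ENNReal.ofReal_mul (by positivity), ← ENNReal.ofReal_natCast Λ.card,
          ← ENNReal.ofReal_mul (by positivity)]
        refine ENNReal.ofReal_le_ofReal ?_
        calc 32 / A * (Λ.card * k + 1) ≤ 32 / A * (Λ.card * (k + 1)) := by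
              gcongr
              linarith
          _ = _ := by ring
    _ = _ := by
        rw [← mul_assoc, ENNReal.inv_mul_cancel (by simpa using hΛ.ne_empty)
          (ENNReal.natCast_ne_top _), one_mul]

theorem cube_nonempty (d N : ℕ) : (cube d N).Nonempty :=
  ⟨0, Finset.mem_Icc.2 ⟨fun _ => by simp, fun _ => by simp⟩⟩

theorem RegularDisorder.exists_moment_bounds (hE : RegularDisorder P E A C m κ)
    (hd : 1 ≤ d) (hA : 0 < A) (hC : 0 < C) (hκ : 0 ≤ κ) (u : Fin d → ℝ) :
    ∃ K : ℝ, 0 < K ∧ ∀ (N : ℕ) (x₀ y₀ : Site d) (h : dist1 y₀ x₀ = 1),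
      ∫⁻ η, ENNReal.ofReal ((η.1 ⟨(y₀, x₀), h⟩ - tilt u (x₀ - y₀)) ^ 2)
        ∂(averagedMeasure P (fun ω => envHamiltonian (E ω)) u (cube d N)) ≤ ENNReal.ofReal K ∧
      ∫⁻ η, ENNReal.ofReal (η.1 ⟨(y₀, x₀), h⟩ ^ 2)
        ∂(averagedMeasure P (fun ω => envHamiltonian (E ω)) u (cube d N)) ≤ ENNReal.ofReal K := by
  have hm0 := hE.mean_nonneg hd
  have hc := energyConst_nonneg u hA hC
  set K := 32 / A * (energyConst d u A C + 2 * (3 ^ d * m) + κ + 1) with hK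
  have hK0 : 0 < K := by positivity
  set T := ∑ i, |u i| with hT
  refine ⟨2 * K + 2 * T ^ 2, by positivity, fun N x₀ y₀ h => ?_⟩
  have h1 := hE.lintegral_sq_le hd hA hC hκ u (cube_nonempty d N) x₀ y₀ h
  have hP := hE.isProbabilityMeasure_averagedMeasure hd hA hC u (cube_nonempty d N)
  refine ⟨h1.trans (ENNReal.ofReal_le_ofReal (by nlinarith [sq_nonneg T])), ?_⟩
  calc ∫⁻ η, ENNReal.ofReal (η.1 ⟨(y₀, x₀), h⟩ ^ 2)
        ∂(averagedMeasure P (fun ω => envHamiltonian (E ω)) u (cube d N))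
      ≤ ∫⁻ η, (ENNReal.ofReal 2 *
          ENNReal.ofReal ((η.1 ⟨(y₀, x₀), h⟩ - tilt u (x₀ - y₀)) ^ 2) +
          ENNReal.ofReal (2 * T ^ 2))
          ∂(averagedMeasure P (fun ω => envHamiltonian (E ω)) u (cube d N)) := by
        refine lintegral_mono fun η => ?_
        rw [← ENNReal.ofReal_mul (by norm_num), ← ENNReal.ofReal_add (by positivity)
          (by positivity)]
        refine ENNReal.ofReal_le_ofReal ?_
        have h2 : tilt u (x₀ - y₀) ^ 2 ≤ T ^ 2 := by
          rw [tilt_sub, ← sq_abs]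
          have := abs_tilt_sub_le u (by rw [dist1_comm]; exact h : dist1 x₀ y₀ = 1)
          gcongr
        -- With `τ` the tilt difference, `2(η - τ)² + 2τ² - η² = (η - 2τ)²`.
        nlinarith [sq_nonneg (η.1 ⟨(y₀, x₀), h⟩ - 2 * tilt u (x₀ - y₀))]
    _ ≤ ENNReal.ofReal 2 * ENNReal.ofReal K + ENNReal.ofReal (2 * T ^ 2) := by
        rw [lintegral_add_right _ measurable_const, lintegral_const, measure_univ, mul_one,
          lintegral_const_mul' _ _ ENNReal.ofReal_ne_top]
        gcongr
    _ = _ := by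
        rw [← ENNReal.ofReal_mul (by norm_num), ← ENNReal.ofReal_add (by positivity)
          (by positivity)]

theorem RegularDisorder.tightWithLimits (hE : RegularDisorder P E A C m κ)
    (hd : 1 ≤ d) (hA : 0 < A) (hC : 0 < C) (hκ : 0 ≤ κ) (u : Fin d → ℝ) :
    TightWithLimits fun N =>
      averagedMeasure P (fun ω => envHamiltonian (E ω)) u (cube d N) := by
  obtain ⟨K, _, hK⟩ := hE.exists_moment_bounds hd hA hC hκ u
  exact tightWithLimits_of_sq_le (K := fun _ => K)
    (fun N => hE.isProbabilityMeasure_averagedMeasure hd hA hC u (cube_nonempty d N))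
    fun N b => (hK N b.1.2 b.1.1 b.2).2

end

/-! ### Both models have regular disorder -/

/-- The function `c/2 s² - V s` is convex and even, hence minimal at the midpoint 0 of `s` and `-s`.
-/
theorem le_add_sq_of_deriv2_le {V : ℝ → ℝ} {c : ℝ} (hV : ContDiff ℝ 2 V) (heven : Function.Even V)
    (h2 : ∀ s, deriv (deriv V) s ≤ c) (s : ℝ) : V s ≤ V 0 + c / 2 * s ^ 2 := by
  have hV1 : Differentiable ℝ V := hV.differentiable (by norm_num)
  have hV2 : Differentiable ℝ (deriv V) :=
    (hV.iterate_deriv' 1 1).differentiable (by norm_num)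
  have hd1 : deriv (fun s => c / 2 * s ^ 2 - V s) = fun s => c * s - deriv V s := by
    funext s
    have h : HasDerivAt (fun s => c / 2 * s ^ 2 - V s) (c / 2 * (2 * s) - deriv V s) s := by
      have h0 := ((hasDerivAt_pow 2 s).const_mul (c / 2)).sub (hV1 s).hasDerivAt
      norm_num at h0
      exact h0
    rw [h.deriv]; ring
  have hconv : ConvexOn ℝ Set.univ fun s => c / 2 * s ^ 2 - V s := by
    refine convexOn_univ_of_deriv2_nonneg (by fun_prop) (by rw [hd1]; fun_prop) fun s => ?_
    have h : HasDerivAt (fun s => c * s - deriv V s) (c * 1 - deriv (deriv V) s) s :=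
      ((hasDerivAt_id s).const_mul c).sub (hV2 s).hasDerivAt
    simp only [Function.iterate_succ, Function.iterate_zero, Function.comp_apply, id_eq, hd1]
    rw [h.deriv]
    linarith [h2 s]
  have h := hconv.2 (Set.mem_univ s) (Set.mem_univ (-s)) (by norm_num : (0 : ℝ) ≤ 1 / 2)
    (by norm_num : (0 : ℝ) ≤ 1 / 2) (by norm_num)
  simp only [smul_eq_mul, heven s] at h
  have e : 1 / 2 * s + 1 / 2 * -s = 0 := by ring
  rw [e] at h
  nlinarith

theorem shift_injective {d : ℕ} (v : Site d) :
    Function.Injective fun b : Bond d => Bond.shift b v := by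
  intro b b' h
  simp only [Bond.shift, Subtype.mk.injEq, Prod.mk.injEq, add_left_inj] at h
  exact Subtype.ext (Prod.ext h.1 h.2)

/-- Two coordinates with strict differences of opposite sign would force distance at least 2. -/
theorem le_or_le_of_dist1 {d : ℕ} {x y : Site d} (h : dist1 x y = 1) : x ≤ y ∨ y ≤ x := by
  by_contra! hcon
  simp only [Pi.le_def, not_forall, not_le] at hcon
  obtain ⟨⟨i, hi⟩, j, hj⟩ := hcon
  have hij : i ≠ j := by rintro rfl; omega
  have h1 : ∑ k ∈ {i, j}, |x k - y k| ≤ dist1 x y :=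
    Finset.sum_le_sum_of_subset_of_nonneg (Finset.subset_univ _) fun _ _ _ => abs_nonneg _
  rw [Finset.sum_pair hij, h, abs_of_pos (by omega), abs_of_neg (by omega)] at h1
  omega

open Classical in
/-- The orientation of a bond that points in a positive coordinate direction. -/
noncomputable def positiveBond {d : ℕ} (b : Bond d) : {b : Bond d // b.1.1 ≤ b.1.2} :=
  if h : b.1.1 ≤ b.1.2 then ⟨b, h⟩ else ⟨b.rev, (le_or_le_of_dist1 b.2).resolve_left h⟩

theorem positiveBond_shift {d : ℕ} (b : Bond d) (v : Site d) :
    (positiveBond (Bond.shift b v)).1 = Bond.shift (positiveBond b).1 v := by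
  unfold positiveBond
  by_cases h : b.1.1 ≤ b.1.2
  · have h' : (Bond.shift b v).1.1 ≤ (Bond.shift b v).1.2 := add_le_add_left h v
    rw [dif_pos h, dif_pos h']
  · have h' : ¬ (Bond.shift b v).1.1 ≤ (Bond.shift b v).1.2 := fun h' =>
      h (le_of_add_le_add_right h')
    rw [dif_neg h, dif_neg h']
    rfl

/-- The law of a family that is i.i.d. over the bonds is translation invariant. -/
theorem map_shift_eq_map {d : ℕ} {Ω F : Type*} [MeasurableSpace Ω] [MeasurableSpace F]
    {P : Measure Ω} [IsProbabilityMeasure P] {X : Bond d → Ω → F} (hX : ∀ b, Measurable (X b))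
    (h : IIDOverBonds P X) (v : Site d) :
    P.map (fun ω b => X (Bond.shift b v) ω) = P.map (fun ω b => X b ω) := by
  obtain ⟨hid, hind | ⟨hrev, hind⟩⟩ := h
  · exact map_relabel_eq_map hX hind hid (shift_injective v)
  -- In the undirected case the whole family is a function of its positive bonds, and taking the
  -- positive orientation commutes with translations.
  · set Y : {b : Bond d // b.1.1 ≤ b.1.2} → Ω → F := fun p => X p.1 with hY
    let τ : {b : Bond d // b.1.1 ≤ b.1.2} → {b : Bond d // b.1.1 ≤ b.1.2} := fun p =>
      ⟨Bond.shift p.1 v, add_le_add_left p.2 v⟩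
    have hτ : Function.Injective τ := fun p q hpq =>
      Subtype.ext (shift_injective v (congrArg Subtype.val hpq))
    have hrel := map_relabel_eq_map (X := Y) (fun p => hX _) hind (fun p q => hid _ _) hτ
    have hXY : ∀ b, X b = Y (positiveBond b) := by
      intro b
      simp only [hY, positiveBond]
      split_ifs
      · rfl
      · exact (hrev b).symm
    have hm : Measurable fun (w : {b : Bond d // b.1.1 ≤ b.1.2} → F) (b : Bond d) =>
        w (positiveBond b) := measurable_pi_lambda _ fun b => measurable_pi_apply _
    have hm1 : Measurable fun ω p => Y (τ p) ω := measurable_pi_lambda _ fun p => hX _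
    have hm2 : Measurable fun ω p => Y p ω := measurable_pi_lambda _ fun p => hX _
    have h1 := congrArg (Measure.map fun (w : {b : Bond d // b.1.1 ≤ b.1.2} → F) (b : Bond d) =>
        w (positiveBond b)) hrel
    rw [Measure.map_map hm hm1, Measure.map_map hm hm2] at h1
    convert h1 using 2
    · funext ω b
      simp only [Function.comp_apply, hXY (Bond.shift b v)]
      congr 2
      exact Subtype.ext (positiveBond_shift b v)
    · funext ω b
      simp only [Function.comp_apply, hXY b]

theorem IIDOverBonds.comp {d : ℕ} {Ω F F' : Type*} [MeasurableSpace Ω] [MeasurableSpace F]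
    [MeasurableSpace F'] {P : Measure Ω} {X : Bond d → Ω → F} (h : IIDOverBonds P X) {g : F → F'}
    (hg : Measurable g) : IIDOverBonds P fun b ω => g (X b ω) := by
  refine ⟨fun b b' => (h.1 b b').comp hg, h.2.imp (fun hi => hi.comp _ fun _ => hg) ?_⟩
  rintro ⟨hrev, hi⟩
  exact ⟨fun b => by simp only [hrev b], hi.comp _ fun _ => hg⟩

theorem regularDisorder_of_iid_field {d : ℕ} (hd : 3 ≤ d) {Ω : Type*} [MeasurableSpace Ω]
    {P : Measure Ω} [IsProbabilityMeasure P] {ξ : Site d → Ω → ℝ} (hξ : ∀ x, Measurable (ξ x))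
    (hind : iIndepFun ξ P) (hid : ∀ x, IdentDistrib (ξ x) (ξ 0) P P) (hL2 : MemLp (ξ 0) 2 P)
    (hmean : ∫ ω, ξ 0 ω ∂P = 0) {V : ℝ → ℝ} {A B C₂ : ℝ} (hA : 0 < A) (hC : 0 < C₂)
    (hV : ContDiff ℝ 2 V) (heven : Function.Even V) (hlow : ∀ s, A * s ^ 2 - B ≤ V s)
    (hup : ∀ s, deriv (deriv V) s ≤ C₂) :
    RegularDisorder P (fun ω => ((fun _ q => V q, fun x => ξ x ω) : Env d)) A C₂
      (|B| + |V 0|) (3 / (2 * (A / 8)) * ∫ ω, ξ 0 ω ^ 2 ∂P) where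
  measurable := measurable_const.prodMk (measurable_pi_lambda _ hξ)
  shift_law v := by
    have h1 := map_relabel_eq_map hξ hind (fun x y => (hid x).trans (hid y).symm)
      (add_left_injective v)
    have hc : Measurable (Prod.mk (fun (_ : Bond d) (q : ℚ) => V q) :
        (Site d → ℝ) → Env d) := measurable_prodMk_left
    have h2 := congrArg (Measure.map (Prod.mk (fun (_ : Bond d) (q : ℚ) => V q) :
        (Site d → ℝ) → Env d)) h1
    rw [Measure.map_map hc (measurable_pi_lambda _ fun x => hξ _),
      Measure.map_map hc (measurable_pi_lambda _ hξ)] at h2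
    exact h2
  potential_bound := by
    refine ⟨fun _ _ => |B| + |V 0|, fun _ _ => by positivity, fun _ => integrable_const _,
      fun _ => by simp, Eventually.of_forall fun ω b s => ?_⟩
    simp only [extendRat_of_continuous hV.continuous]
    have h1 := le_add_sq_of_deriv2_le hV heven hup s
    have h2 : 0 ≤ C₂ * s ^ 2 := by positivity
    exact ⟨by linarith [hlow s, le_abs_self B, abs_nonneg (V 0)],
      by linarith [le_abs_self (V 0), abs_nonneg B]⟩
  field_bound Λ := by
    have hsq : ∀ x, ∫ ω, ξ x ω ^ 2 ∂P = ∫ ω, ξ 0 ω ^ 2 ∂P := fun x =>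
      ((hid x).comp (measurable_id.pow_const 2)).integral_eq
    refine exists_field_bound hd (fun x => (hid x).memLp_iff.2 hL2) (fun x y hxy => ?_)
      (fun x => (hsq x).le) (by positivity) Λ
    have h := (hind.indepFun hxy).integral_mul_eq_mul_integral (hξ x).aestronglyMeasurable
      (hξ y).aestronglyMeasurable
    rw [(hid x).integral_eq, hmean, zero_mul] at h
    exact h

theorem regularDisorder_of_iid_potential {d : ℕ} (hd : 1 ≤ d) {Ω : Type*} [MeasurableSpace Ω]
    {P : Measure Ω} [IsProbabilityMeasure P] {V : Bond d → Ω → ℝ → ℝ} {B : Bond d → Ω → ℝ}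
    {A C₂ : ℝ} (hA : 0 < A) (hVm : ∀ b, Measurable fun p : Ω × ℝ => V b p.1 p.2)
    (hV : IIDOverBonds P V) (hB : IIDOverBonds P B) (hBi : ∀ b, Integrable (B b) P)
    (hVc : ∀ b ω, Continuous (V b ω))
    (hbd : ∀ᵐ ω ∂P, ∀ b s, A * s ^ 2 - B b ω ≤ V b ω s ∧ V b ω s ≤ C₂ * s ^ 2) :
    ∃ m, RegularDisorder P (fun ω => ((fun b q => V b ω q, 0) : Env d)) A C₂ m 0 := by
  have hVs : ∀ b (s : ℝ), Measurable fun ω => V b ω s := fun b s =>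
    (hVm b).comp measurable_prodMk_right
  have hg : Measurable fun (f : ℝ → ℝ) (q : ℚ) => f q :=
    measurable_pi_lambda _ fun q => measurable_pi_apply _
  have hX : ∀ b, Measurable fun ω (q : ℚ) => V b ω q := fun b =>
    measurable_pi_lambda _ fun q => hVs b q
  have hXb : Measurable fun ω b (q : ℚ) => V b ω q := measurable_pi_lambda _ hX
  let b₀ : Bond d := ⟨(0, Pi.single ⟨0, hd⟩ 1), dist1_zero_single _⟩
  refine ⟨∫ ω, |B b₀ ω| ∂P, ?_, fun v => ?_, ?_, fun Λ => ?_⟩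
  · exact hXb.prodMk measurable_const
  · have h1 := map_shift_eq_map hX (hV.comp hg) v
    have hc : Measurable (fun w => (w, 0) : (Bond d → ℚ → ℝ) → Env d) := measurable_prodMk_right
    have h2 := congrArg (Measure.map (fun w => (w, 0) : (Bond d → ℚ → ℝ) → Env d)) h1
    rw [Measure.map_map hc (measurable_pi_lambda _ fun b => hX _), Measure.map_map hc hXb] at h2
    exact h2
  · refine ⟨fun b ω => |B b ω|, fun _ _ => abs_nonneg _, fun b => (hBi b).abs, fun b => ?_, ?_⟩
    · exact ((hB.1 b b₀).comp measurable_norm).integral_eq.le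
    · filter_upwards [hbd] with ω hω b s
      simp only [extendRat_of_continuous (hVc b ω)]
      obtain ⟨h1, h2⟩ := hω b s
      exact ⟨by linarith [le_abs_self (B b ω)], by linarith [abs_nonneg (B b ω)]⟩
  · refine ⟨fun _ => 0, fun _ => le_rfl, integrable_zero _ _ _, by simp, fun ω φ _ => ?_⟩
    have := dirichlet_nonneg Λ φ
    simp only [Pi.zero_apply, zero_mul, Finset.sum_const_zero, mul_zero, sub_zero]
    have : 0 ≤ A / 8 * dirichlet Λ φ := by positivity
    linarith

end RandomInterface

theorem mainTheorem6 {d : ℕ} (u : Fin d → ℝ)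
    {Ω : Type*} [MeasurableSpace Ω] (P : Measure Ω) [IsProbabilityMeasure P] :
    -- Model A: i.i.d. centred external fields, `d ≥ 3`
    (3 ≤ d →
      ∀ (ξ : RandomInterface.Site d → Ω → ℝ),
      (∀ x, Measurable (ξ x)) → iIndepFun ξ P → (∀ x, IdentDistrib (ξ x) (ξ 0) P P) →
      MemLp (ξ 0) 2 P → (∫ ω, ξ 0 ω ^ 2 ∂P) ≠ 0 → (∫ ω, ξ 0 ω ∂P) = 0 →
      ∀ (V : ℝ → ℝ) (A B C₂ : ℝ), 0 < A → 0 < C₂ → ContDiff ℝ 2 V → Function.Even V →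
      (∀ s, A * s ^ 2 - B ≤ V s) → (∀ s, deriv (deriv V) s ≤ C₂) →
      (∃ K : ℝ, 0 < K ∧
        ∀ (x₀ y₀ : RandomInterface.Site d) (h : RandomInterface.dist1 y₀ x₀ = 1),
          limsup (fun N : ℕ => ∫⁻ η, ENNReal.ofReal
              ((η.1 ⟨(y₀, x₀), h⟩ - RandomInterface.tilt u (x₀ - y₀)) ^ 2)
            ∂(RandomInterface.averagedMeasure P
                (fun ω => RandomInterface.hamiltonianA V fun x => ξ x ω) u
                (RandomInterface.cube d N))) atTop ≤ ENNReal.ofReal K) ∧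
      RandomInterface.TightWithLimits fun N => RandomInterface.averagedMeasure P
        (fun ω => RandomInterface.hamiltonianA V fun x => ξ x ω) u (RandomInterface.cube d N)) ∧
    -- Model B: i.i.d. bond potentials, `d ≥ 1`
    (1 ≤ d →
      ∀ (V : RandomInterface.Bond d → Ω → ℝ → ℝ) (B : RandomInterface.Bond d → Ω → ℝ) (A C₂ : ℝ),
      0 < A → 0 < C₂ →
      (∀ b, Measurable fun p : Ω × ℝ => V b p.1 p.2) → RandomInterface.IIDOverBonds P V →
      (∀ b, Measurable (B b)) → RandomInterface.IIDOverBonds P B → (∀ b, Integrable (B b) P) →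
      (∀ b ω, ContDiff ℝ 2 (V b ω)) → (∀ b ω, Function.Even (V b ω)) →
      (∀ᵐ ω ∂P, ∀ b s, A * s ^ 2 - B b ω ≤ V b ω s ∧ V b ω s ≤ C₂ * s ^ 2) →
      (∃ K : ℝ, 0 < K ∧
        ∀ (x₀ y₀ : RandomInterface.Site d) (h : RandomInterface.dist1 y₀ x₀ = 1),
          limsup (fun N : ℕ => ∫⁻ η, ENNReal.ofReal (η.1 ⟨(y₀, x₀), h⟩ ^ 2)
            ∂(RandomInterface.averagedMeasure P
                (fun ω => RandomInterface.hamiltonianB fun b => V b ω) u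
                (RandomInterface.cube d N))) atTop ≤ ENNReal.ofReal K) ∧
      RandomInterface.TightWithLimits fun N => RandomInterface.averagedMeasure P
        (fun ω => RandomInterface.hamiltonianB fun b => V b ω) u (RandomInterface.cube d N)) := by
  refine ⟨fun hd ξ hξ hind hid hL2 _ hmean V A B C₂ hA hC hV heven hlow hup => ?_,
    fun hd V B A C₂ hA hC hVm hV _ hB hBi hV2 _ hbd => ?_⟩
  · have hE := RandomInterface.regularDisorder_of_iid_field hd hξ hind hid hL2 hmean hA hC hV heven
      hlow hup
    -- Continuity of the potential makes its restriction to `ℚ` lossless, so the model is an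
    -- instance of `envHamiltonian`.
    have hH : (fun ω => RandomInterface.hamiltonianA (d := d) V fun x => ξ x ω) = fun ω =>
        RandomInterface.envHamiltonian (fun _ q => V q, fun x => ξ x ω) := by
      funext ω
      rw [RandomInterface.hamiltonianA_eq_hamiltonian, RandomInterface.envHamiltonian]
      simp only [RandomInterface.extendRat_of_continuous hV.continuous]
    have hκ : 0 ≤ 3 / (2 * (A / 8)) * ∫ ω, ξ 0 ω ^ 2 ∂P :=
      mul_nonneg (by positivity) (integral_nonneg fun ω => sq_nonneg _)
    rw [hH]
    refine ⟨?_, hE.tightWithLimits (by omega) hA hC hκ u⟩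
    obtain ⟨K, hK, h⟩ := hE.exists_moment_bounds (by omega) hA hC hκ u
    -- The bound holds for every `N`, not only in the limit.
    exact ⟨K, hK, fun x₀ y₀ hb => limsup_le_of_le (h := Eventually.of_forall fun N =>
      (h N x₀ y₀ hb).1)⟩
  · have hVc : ∀ b ω, Continuous (V b ω) := fun b ω => (hV2 b ω).continuous
    obtain ⟨m, hE⟩ := RandomInterface.regularDisorder_of_iid_potential hd hA hVm hV hB hBi hVc hbd
    have hH : (fun ω => RandomInterface.hamiltonianB fun b => V b ω) = fun ω =>
        RandomInterface.envHamiltonian (fun b q => V b ω q, 0) := by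
      funext ω
      rw [RandomInterface.hamiltonianB_eq_hamiltonian, RandomInterface.envHamiltonian]
      simp only [RandomInterface.extendRat_of_continuous (hVc _ ω)]
    rw [hH]
    refine ⟨?_, hE.tightWithLimits hd hA hC le_rfl u⟩
    obtain ⟨K, hK, h⟩ := hE.exists_moment_bounds hd hA hC le_rfl u
    exact ⟨K, hK, fun x₀ y₀ hb => limsup_le_of_le (h := Eventually.of_forall fun N =>
      (h N x₀ y₀ hb).2)⟩
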